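/- Let $\Bbbk$ be a field, let $n > c \ge 3$ be integers, and let $S=\Bbbk[x_1,\dots,x_n]$ with the standard grading. Let $$I_{n,c}^{(3)}=\bigcap_{1\le i_1<\dots<i_c\le n}(x_{i_1},\dots,x_{i_c})^3$$ be the third symbolic power (symbolic cube) of the ideal $I_{n,c}=\bigcap_{1\le i_1<\dots<i_c\le n}(x_{i_1},\dots,x_{i_c})$. For a homogeneous ideal $I\subseteq S$ let $\beta_{i,j}(I)=\dim_\Bbbk \operatorname{Tor}_i^S(I,\Bbbk)_j$ denote its graded Betti numbers. Then for all integers $i\ge 0$ and $j$, $$\beta_{i,i+j}\bigl(I_{n,c}^{(3)}\bigr)=\begin{cases} \binom{n}{c-3-i}\binom{n-c+2+i}{i}, & j=n-c+3,\\ \binom{n}{c-2}\left(\binom{c-2}{i}+(n-c+1)\binom{c-1}{i}\right), & j=2(n-c+1)+1,\\ \binom{n}{c-1}\binom{c-1}{i}, & j=3(n-c+1),\\ 0, & \text{otherwise,} \end{cases}$$ where $\binom{a}{b}=0$ if $b<0$ or $b>a\ge 0$. -/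

import Mathlib

universe u

section StarConfiguration

variable (k : Type u) [Field k]

/-- The monomial prime `(x_a : a ∈ s)` of `k[x_1, …, x_n]`. -/
noncomputable def varIdeal (n : ℕ) (s : Finset (Fin n)) : Ideal (MvPolynomial (Fin n) k) :=
  Ideal.span (MvPolynomial.X '' (s : Set (Fin n)))

/-- The `m`-th symbolic power `I_{n,c}^{(m)} = ⋂ (x_{i_1}, …, x_{i_c})^m`, the intersection being
over all `i_1 < ⋯ < i_c`; for `m = 1` this is the ideal `I_{n,c}` itself. -/
noncomputable def starSymbolicPower (n c m : ℕ) : Ideal (MvPolynomial (Fin n) k) :=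
  ⨅ s : {s : Finset (Fin n) // s.card = c}, varIdeal k n s.1 ^ m

end StarConfiguration

section Betti

variable {k : Type u} [Field k] {n : ℕ}

/-- `p` is zero or homogeneous of degree `d`; here `d` is an integer, so that `p = 0` if `d < 0`. -/
def IsHomogOfDegree (p : MvPolynomial (Fin n) k) (d : ℤ) : Prop :=
  ∀ m ∈ p.support, (m.degree : ℤ) = d

/-- A graded free resolution
`⋯ → F_2 → F_1 → F_0 → I → 0` over `S = k[x_1, …, x_n]`, where
`F_i = ⨁_{b ∈ B i} S(-deg i b)`, that is, the basis element `b` of `F_i` has degree `deg i b`.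
The maps are homogeneous of degree zero: the image of each basis element `b` is homogeneous of
the degree of `b`, which for the coordinate at the basis element `b'` means that it is a
homogeneous polynomial of degree `deg b - deg b'`.
No finiteness and no minimality is asked for. -/
structure GradedFreeResolution (I : Ideal (MvPolynomial (Fin n) k)) where
  /-- the homogeneous basis of `F_i` -/
  B : ℕ → Type u
  /-- the degrees of the basis elements -/
  deg : ∀ i, B i → ℤ
  /-- the differential `F_{i+1} → F_i` -/
  d : ∀ i, (B (i + 1) →₀ MvPolynomial (Fin n) k) →ₗ[MvPolynomial (Fin n) k]
    (B i →₀ MvPolynomial (Fin n) k)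
  /-- the augmentation `F_0 → I ⊆ S` -/
  ε : (B 0 →₀ MvPolynomial (Fin n) k) →ₗ[MvPolynomial (Fin n) k] MvPolynomial (Fin n) k
  homog_d : ∀ i (b : B (i + 1)) (b' : B i),
    IsHomogOfDegree (d i (Finsupp.single b 1) b') (deg (i + 1) b - deg i b')
  homog_ε : ∀ b : B 0, IsHomogOfDegree (ε (Finsupp.single b 1)) (deg 0 b)
  range_ε : LinearMap.range ε = I
  exact_zero : LinearMap.ker ε = LinearMap.range (d 0)
  exact_succ : ∀ i, LinearMap.ker (d i) = LinearMap.range (d (i + 1))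

/-- The reduction `F → F ⊗_S k = F / (x_1, …, x_n) F` of a free module, where `k = S / (x_1, …, x_n)`:
if `F` has basis `B` over `S`, then `F ⊗_S k` has basis `B` over `k`, and coefficients are replaced by
their constant terms. -/
noncomputable def reduceFree {B : Type u} (f : B →₀ MvPolynomial (Fin n) k) : B →₀ k :=
  f.mapRange MvPolynomial.constantCoeff (map_zero _)

/-- The quotient `Z / (Z ∩ W)` of subspaces of a vector space, that is `Z / W` if `W ≤ Z`. -/
abbrev Subquotient {V : Type u} [AddCommGroup V] [Module k V] (Z W : Submodule k V) : Type u :=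
  Z ⧸ W.submoduleOf Z

namespace GradedFreeResolution

variable {I : Ideal (MvPolynomial (Fin n) k)} (F : GradedFreeResolution I)

/-- The differential `F_{i+1} ⊗_S k → F_i ⊗_S k`. -/
noncomputable def dBar (i : ℕ) : (F.B (i + 1) →₀ k) →ₗ[k] (F.B i →₀ k) :=
  Finsupp.linearCombination k fun b => reduceFree (F.d i (Finsupp.single b 1))

/-- The map `dBar` is indeed induced by `d`. -/
theorem dBar_reduceFree (i : ℕ) (f : F.B (i + 1) →₀ MvPolynomial (Fin n) k) :
    F.dBar i (reduceFree f) = reduceFree (F.d i f) := by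
  induction f using Finsupp.induction_linear with
  | zero => simp [reduceFree]
  | add f g hf hg =>
    have h : ∀ {B : Type u} (f g : B →₀ MvPolynomial (Fin n) k),
        reduceFree (f + g) = reduceFree f + reduceFree g := fun f g =>
      Finsupp.mapRange_add (map_add _) f g
    rw [h, map_add, map_add, h, hf, hg]
  | single b p =>
    have h : Finsupp.single b p = p • Finsupp.single b (1 : MvPolynomial (Fin n) k) := by simp
    rw [h, map_smul, ← h]
    ext b'
    simp [reduceFree, dBar, Finsupp.linearCombination_single]

/-- The maps `dBar` form a complex. -/
theorem dBar_dBar (i : ℕ) (f : F.B (i + 2) →₀ k) : F.dBar i (F.dBar (i + 1) f) = 0 := by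
  have h : f = reduceFree (f.mapRange (MvPolynomial.C (σ := Fin n)) (map_zero _)) := by
    ext b; simp [reduceFree]
  rw [h, dBar_reduceFree, dBar_reduceFree]
  have h2 : F.d i (F.d (i + 1) (f.mapRange (MvPolynomial.C (σ := Fin n)) (map_zero _))) = 0 := by
    rw [← LinearMap.mem_ker, F.exact_succ]
    exact LinearMap.mem_range_self _ _
  rw [h2]
  simp [reduceFree]

/-- The degree `e` part of `F_i ⊗_S k`: the span of the basis elements of degree `e`. -/
noncomputable def strand (i : ℕ) (e : ℤ) : Submodule k (F.B i →₀ k) :=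
  Finsupp.supported k k {b | F.deg i b = e}

/-- The cycles of `F ⊗_S k` in homological degree `i`. -/
noncomputable def cycles : (i : ℕ) → Submodule k (F.B i →₀ k)
  | 0 => ⊤
  | i + 1 => LinearMap.ker (F.dBar i)

/-- The boundaries of degree `e` in homological degree `i`: the image under `dBar` of the degree `e`
part of `F_{i+1} ⊗_S k`. -/
noncomputable def boundaries (i : ℕ) (e : ℤ) : Submodule k (F.B i →₀ k) :=
  (F.strand (i + 1) e).map (F.dBar i)

/-- The boundaries of degree `e` are cycles of degree `e`. -/
theorem boundaries_le (i : ℕ) (e : ℤ) : F.boundaries i e ≤ F.cycles i ⊓ F.strand i e := by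
  rintro _ ⟨f, hf, rfl⟩
  refine ⟨?_, ?_⟩
  · cases i with
    | zero => trivial
    | succ i => exact F.dBar_dBar i f
  · have hf' : ∀ b ∈ f.support, F.deg (i + 1) b = e := fun b hb => hf hb
    rw [SetLike.mem_coe, dBar, Finsupp.linearCombination_apply]
    refine Submodule.sum_mem _ fun b hb => Submodule.smul_mem _ _ ?_
    intro b' hb'
    have h0 : MvPolynomial.coeff 0 (F.d i (Finsupp.single b 1) b') ≠ 0 := by
      simpa [reduceFree, MvPolynomial.constantCoeff_eq] using hb'
    have h1 := F.homog_d i b b' 0 (MvPolynomial.mem_support_iff.2 h0)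
    have h2 := hf' b hb
    simp only [map_zero, Nat.cast_zero] at h1
    simp only [Set.mem_ofPred_eq]
    omega

/-- `Tor_i^S(I, k)_e`, computed from `F`: the homology in homological degree `i` of the degree `e`
part of the complex `F ⊗_S k`, namely the cycles of degree `e` modulo the boundaries of degree `e`. -/
abbrev Tor (i : ℕ) (e : ℤ) : Type u :=
  Subquotient (F.cycles i ⊓ F.strand i e) (F.boundaries i e)

end GradedFreeResolution

/-- `β_{i,e}(I) = dim_k Tor_i^S(I, k)_e` is equal to the natural number `β`: graded free resolutions
of `I` exist, and `Tor_i^S(I, k)_e` has dimension `β` when computed from any of them. -/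
def HasGradedBetti (I : Ideal (MvPolynomial (Fin n) k)) (i : ℕ) (e : ℤ) (β : ℕ) : Prop :=
  Nonempty (GradedFreeResolution I) ∧
    ∀ F : GradedFreeResolution I, Module.rank k (F.Tor i e) = β

end Betti

/-! ### Homogeneous elements and graded maps of graded free modules. -/

section GradedMaps

variable {k : Type u} [Field k] {n : ℕ}

local notation "𝒮" => MvPolynomial (Fin n) k

namespace IsHomogOfDegree

/-! Put `m = n - c`. A monomial lies in the symbolic cube iff its exponents sum to at least 3 over
every `c`-set of variables. Looking at the size of the support yields generators of three kinds:
`x_T` with `|T| = m + 3`, `x_W ^ 2 / x_w` with `w ∈ W` and `|W| = m + 2`, and `x_W ^ 3` with `|W| =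
m + 1` (`exists_cubeExponent_le_iff`).

In the order given by `cubeRank` these have linear quotients: the ideal of the earlier generators,
colon the next one, is generated by variables (`cubeColon_sound`, `cubeColon_complete`). Adding a
generator `u` of degree `t` to `I` amounts to taking the cone of a map from the Koszul complex on
these variables, shifted by `t`, to the resolution of `S / I`. Since degrees do not decrease along
the order, the cone is minimal for degree reasons, so `u` contributes `r.choose i` to the Betti
number of the ideal in homological degree `i` and internal degree `t + i`, where `r` is the number
of variables (`hasMinimalResolution_of_linearQuotients`). Summing over the three kinds gives the
formula.

That a minimal resolution computes Tor from an arbitrary graded free resolution is the comparison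
theorem, reduced modulo the variables (`GradedFreeResolution.rank_tor`). -/

theorem zero (d : ℤ) : IsHomogOfDegree (0 : 𝒮) d := by
  intro m hm; simp at hm

theorem add {p q : 𝒮} {d : ℤ} (hp : IsHomogOfDegree p d) (hq : IsHomogOfDegree q d) :
    IsHomogOfDegree (p + q) d := by
  classical
  intro m hm
  rcases Finset.mem_union.1 (MvPolynomial.support_add hm) with h | h
  exacts [hp m h, hq m h]

theorem mul {p q : 𝒮} {d e : ℤ} (hp : IsHomogOfDegree p d) (hq : IsHomogOfDegree q e) :
    IsHomogOfDegree (p * q) (d + e) := by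
  classical
  intro m hm
  obtain ⟨a, ha, b, hb, rfl⟩ := Finset.mem_add.1 (MvPolynomial.support_mul p q hm)
  rw [map_add, Nat.cast_add, hp a ha, hq b hb]

theorem monomial (m : Fin n →₀ ℕ) (a : k) :
    IsHomogOfDegree (MvPolynomial.monomial m a) (m.degree : ℤ) := by
  intro m' hm'
  have := MvPolynomial.support_monomial_subset hm'
  rw [Finset.mem_singleton.1 this]

theorem neg {p : 𝒮} {d : ℤ} (hp : IsHomogOfDegree p d) : IsHomogOfDegree (-p) d := by
  intro m hm
  rw [MvPolynomial.support_neg] at hm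
  exact hp m hm

theorem one : IsHomogOfDegree (1 : 𝒮) 0 := by
  simpa using monomial (k := k) (0 : Fin n →₀ ℕ) 1

theorem constantCoeff_eq_zero {p : 𝒮} {d : ℤ} (hp : IsHomogOfDegree p d) (hd : d ≠ 0) :
    MvPolynomial.constantCoeff p = 0 := by
  by_contra h
  rw [MvPolynomial.constantCoeff_eq] at h
  have := hp 0 (MvPolynomial.mem_support_iff.2 h)
  simp at this
  exact hd this.symm

end IsHomogOfDegree

/-- The part of degree `j ∈ ℤ` of a polynomial. -/
noncomputable def intComponent (j : ℤ) : 𝒮 →+ 𝒮 :=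
  if 0 ≤ j then (MvPolynomial.homogeneousComponent j.toNat).toAddMonoidHom else 0

theorem coeff_intComponent (j : ℤ) (p : 𝒮) (m : Fin n →₀ ℕ) :
    (intComponent j p).coeff m = if (m.degree : ℤ) = j then p.coeff m else 0 := by
  unfold intComponent
  split_ifs with h1 h2 h2
  · rw [LinearMap.toAddMonoidHom_coe, MvPolynomial.coeff_homogeneousComponent, if_pos (by omega)]
  · rw [LinearMap.toAddMonoidHom_coe, MvPolynomial.coeff_homogeneousComponent, if_neg (by omega)]
  · omega
  · simp

theorem isHomogOfDegree_intComponent (j : ℤ) (p : 𝒮) : IsHomogOfDegree (intComponent j p) j := by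
  intro m hm
  rw [MvPolynomial.mem_support_iff, coeff_intComponent] at hm
  by_contra h
  simp [h] at hm

theorem IsHomogOfDegree.intComponent_eq {p : 𝒮} {d : ℤ} (hp : IsHomogOfDegree p d) (j : ℤ) :
    intComponent j p = if d = j then p else 0 := by
  ext m
  rw [coeff_intComponent]
  by_cases hm : p.coeff m = 0
  · split_ifs <;> simp [hm]
  · have := hp m (MvPolynomial.mem_support_iff.2 hm)
    rw [this]
    split_ifs <;> simp

variable {B C D : Type u}

/-- The element `f` of the graded free module with basis `B` is homogeneous of degree `e`. -/
def IsHomogElt (deg : B → ℤ) (f : B →₀ 𝒮) (e : ℤ) : Prop :=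
  ∀ b, IsHomogOfDegree (f b) (e - deg b)

namespace IsHomogElt

variable {deg : B → ℤ} {f g : B →₀ MvPolynomial (Fin n) k} {e : ℤ}

theorem zero (deg : B → ℤ) (e : ℤ) : IsHomogElt deg (0 : B →₀ 𝒮) e :=
  fun _ => IsHomogOfDegree.zero _

theorem add (hf : IsHomogElt deg f e) (hg : IsHomogElt deg g e) : IsHomogElt deg (f + g) e :=
  fun b => (hf b).add (hg b)

theorem neg (hf : IsHomogElt deg f e) : IsHomogElt deg (-f) e :=
  fun b => (hf b).neg

theorem sub (hf : IsHomogElt deg f e) (hg : IsHomogElt deg g e) : IsHomogElt deg (f - g) e := by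
  rw [sub_eq_add_neg]; exact hf.add hg.neg

theorem smul {p : 𝒮} {d : ℤ} (hp : IsHomogOfDegree p d) (hf : IsHomogElt deg f e) :
    IsHomogElt deg (p • f) (d + e) := by
  intro b
  rw [add_sub_assoc]
  exact hp.mul (hf b)

theorem single {p : 𝒮} {d : ℤ} (hp : IsHomogOfDegree p d) (b : B) :
    IsHomogElt deg (Finsupp.single b p) (deg b + d) := by
  classical
  intro b'
  rw [Finsupp.single_apply]
  split_ifs with h
  · subst h; simpa using hp
  · exact IsHomogOfDegree.zero _

theorem sum {ι : Type*} (s : Finset ι) (f : ι → B →₀ 𝒮)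
    (h : ∀ i ∈ s, IsHomogElt deg (f i) e) : IsHomogElt deg (∑ i ∈ s, f i) e :=
  Finset.sum_induction f (IsHomogElt deg · e) (fun _ _ => add) (zero deg e) h

end IsHomogElt

/-- The linear map `φ` of graded free modules is homogeneous of degree `t`. -/
def IsGradedMap (degB : B → ℤ) (degC : C → ℤ) (φ : (B →₀ 𝒮) →ₗ[𝒮] (C →₀ 𝒮)) (t : ℤ) : Prop :=
  ∀ b, IsHomogElt degC (φ (Finsupp.single b 1)) (degB b + t)

variable {degB : B → ℤ} {degC : C → ℤ} {degD : D → ℤ}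

theorem IsGradedMap.map {φ : (B →₀ 𝒮) →ₗ[𝒮] (C →₀ 𝒮)} {t : ℤ} (hφ : IsGradedMap degB degC φ t)
    {f : B →₀ 𝒮} {e : ℤ} (hf : IsHomogElt degB f e) : IsHomogElt degC (φ f) (e + t) := by
  have h : φ f = ∑ b ∈ f.support, f b • φ (Finsupp.single b 1) := by
    conv_lhs => rw [← Finsupp.sum_single f]
    rw [Finsupp.sum, map_sum]
    refine Finset.sum_congr rfl fun b _ => ?_
    rw [← map_smul]; simp
  rw [h]
  refine IsHomogElt.sum _ _ fun b _ => ?_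
  have := IsHomogElt.smul (hf b) (hφ b)
  convert this using 1
  ring

theorem IsGradedMap.comp {ψ : (C →₀ 𝒮) →ₗ[𝒮] (D →₀ 𝒮)} {φ : (B →₀ 𝒮) →ₗ[𝒮] (C →₀ 𝒮)} {s t : ℤ}
    (hψ : IsGradedMap degC degD ψ s) (hφ : IsGradedMap degB degC φ t) :
    IsGradedMap degB degD (ψ ∘ₗ φ) (t + s) := by
  intro b
  rw [← add_assoc]
  exact hψ.map (hφ b)

theorem IsGradedMap.id : IsGradedMap degB degB (LinearMap.id : (B →₀ 𝒮) →ₗ[𝒮] _) 0 := by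
  intro b
  exact IsHomogElt.single IsHomogOfDegree.one b

/-- The part of degree `e` of an element of a graded free module. -/
noncomputable def eltComponent (deg : B → ℤ) (e : ℤ) : (B →₀ 𝒮) →+ (B →₀ 𝒮) :=
  Finsupp.liftAddHom fun b => (Finsupp.singleAddHom b).comp (intComponent (e - deg b))

theorem eltComponent_single (deg : B → ℤ) (e : ℤ) (b : B) (p : 𝒮) :
    eltComponent deg e (Finsupp.single b p) = Finsupp.single b (intComponent (e - deg b) p) := by
  simp [eltComponent]

theorem eltComponent_apply (deg : B → ℤ) (e : ℤ) (f : B →₀ 𝒮) (b : B) :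
    eltComponent deg e f b = intComponent (e - deg b) (f b) := by
  classical
  induction f using Finsupp.induction_linear with
  | zero => simp
  | add f g hf hg => simp [hf, hg]
  | single b' p =>
    rw [eltComponent_single, Finsupp.single_apply, Finsupp.single_apply]
    split_ifs with h
    · rw [h]
    · simp

theorem isHomogElt_eltComponent (deg : B → ℤ) (e : ℤ) (f : B →₀ 𝒮) :
    IsHomogElt deg (eltComponent deg e f) e := by
  intro b
  rw [eltComponent_apply]
  exact isHomogOfDegree_intComponent _ _

theorem IsHomogElt.eltComponent_eq {deg : B → ℤ} {f : B →₀ 𝒮} {d : ℤ} (hf : IsHomogElt deg f d)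
    (e : ℤ) : eltComponent deg e f = if d = e then f else 0 := by
  ext1 b
  rw [eltComponent_apply, (hf b).intComponent_eq]
  by_cases h : d = e <;> simp [h]

/-- Both sides are additive in `f`, so it is enough to test a monomial times a basis element, which
is homogeneous. This is what allows preimages to be made homogeneous. -/
theorem IsGradedMap.map_eltComponent {φ : (B →₀ 𝒮) →ₗ[𝒮] (C →₀ 𝒮)} {t : ℤ}
    (hφ : IsGradedMap degB degC φ t) (e : ℤ) (f : B →₀ 𝒮) :
    φ (eltComponent degB e f) = eltComponent degC (e + t) (φ f) := by
  induction f using Finsupp.induction_linear with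
  | zero => simp
  | add f g hf hg => simp [hf, hg]
  | single b p =>
    induction p using MvPolynomial.induction_on' with
    | monomial m a =>
      have h := IsHomogElt.single (deg := degB) (IsHomogOfDegree.monomial m a) b
      rw [h.eltComponent_eq, (hφ.map h).eltComponent_eq]
      split_ifs <;> simp_all
    | add p q hp hq => simp only [Finsupp.single_add, map_add, hp, hq]

/-- A homogeneous element of the range of a graded map is the image of a homogeneous element. -/
theorem IsGradedMap.exists_homog_preimage {φ : (B →₀ 𝒮) →ₗ[𝒮] (C →₀ 𝒮)}
    (hφ : IsGradedMap degB degC φ 0) {f : C →₀ 𝒮} {e : ℤ} (hf : IsHomogElt degC f e)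
    (hr : f ∈ LinearMap.range φ) : ∃ g, IsHomogElt degB g e ∧ φ g = f := by
  obtain ⟨g, rfl⟩ := hr
  refine ⟨eltComponent degB e g, isHomogElt_eltComponent _ _ _, ?_⟩
  rw [hφ.map_eltComponent, hf.eltComponent_eq]
  simp

/-- A graded map whose range lies in the range of another graded map factors through it. -/
theorem IsGradedMap.exists_lift {φ : (B →₀ 𝒮) →ₗ[𝒮] (C →₀ 𝒮)} (hφ : IsGradedMap degB degC φ 0)
    {ψ : (D →₀ 𝒮) →ₗ[𝒮] (C →₀ 𝒮)} {t : ℤ} (hψ : IsGradedMap degD degC ψ t)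
    (hr : ∀ f, ψ f ∈ LinearMap.range φ) :
    ∃ χ : (D →₀ 𝒮) →ₗ[𝒮] (B →₀ 𝒮), IsGradedMap degD degB χ t ∧ φ ∘ₗ χ = ψ := by
  choose g hg hg' using fun b => hφ.exists_homog_preimage (hψ b) (hr (Finsupp.single b 1))
  refine ⟨Finsupp.linearCombination _ g, fun b => ?_, ?_⟩
  · simpa [Finsupp.linearCombination_single] using hg b
  · refine Finsupp.lhom_ext' fun b => LinearMap.ext_ring ?_
    simp [Finsupp.linearCombination_single, hg']

end GradedMaps

/-! ### Comparison of graded resolutions, and Tor from a minimal resolution. -/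

section Comparison

variable {k : Type u} [Field k] {n : ℕ}

local notation "𝒮" => MvPolynomial (Fin n) k

/-- A graded free resolution `⋯ → F_2 → F_1 → F_0 → S / I → 0` with `F_0` of rank one, generated in
degree zero. -/
structure QuotientResolution (I : Ideal (MvPolynomial (Fin n) k)) where
  /-- the homogeneous basis of `F_i` -/
  B : ℕ → Type u
  /-- `F_0` has rank one -/
  uniqueZero : Unique (B 0)
  /-- the degrees of the basis elements -/
  deg : ∀ i, B i → ℤ
  deg_zero : ∀ b, deg 0 b = 0
  /-- the differential `F_{i+1} → F_i` -/
  d : ∀ i, (B (i + 1) →₀ MvPolynomial (Fin n) k) →ₗ[MvPolynomial (Fin n) k]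
    (B i →₀ MvPolynomial (Fin n) k)
  isGradedMap_d : ∀ i, IsGradedMap (deg (i + 1)) (deg i) (d i) 0
  mem_range_zero : ∀ f, f ∈ LinearMap.range (d 0) ↔ ∀ b, f b ∈ I
  exact : ∀ i, LinearMap.ker (d i) = LinearMap.range (d (i + 1))

namespace QuotientResolution

variable {I J : Ideal (MvPolynomial (Fin n) k)}

theorem d_d (G : QuotientResolution I) (i : ℕ) (f) : G.d i (G.d (i + 1) f) = 0 := by
  rw [← LinearMap.mem_ker, G.exact]
  exact LinearMap.mem_range_self _ _

/-- The comparison theorem: a graded map `F_0 → G_0` that sends the image of `F_1` to the image of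
`G_1` extends to a graded map of complexes. -/
theorem exists_chainMap (F : QuotientResolution I) (G : QuotientResolution J) {t : ℤ}
    (φ₀ : (F.B 0 →₀ 𝒮) →ₗ[𝒮] (G.B 0 →₀ 𝒮)) (h₀ : IsGradedMap (F.deg 0) (G.deg 0) φ₀ t)
    (hr : ∀ f, φ₀ (F.d 0 f) ∈ LinearMap.range (G.d 0)) :
    ∃ φ : ∀ i, (F.B i →₀ 𝒮) →ₗ[𝒮] (G.B i →₀ 𝒮), φ 0 = φ₀ ∧
      (∀ i, IsGradedMap (F.deg i) (G.deg i) (φ i) t) ∧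
      ∀ i f, G.d i (φ (i + 1) f) = φ i (F.d i f) := by
  -- The second condition is the invariant of the recursion: it is exactly what is needed to lift `φ
  -- ∘ d` through `G.d i`.
  let P : ∀ i, ((F.B i →₀ 𝒮) →ₗ[𝒮] (G.B i →₀ 𝒮)) → Prop := fun i φ =>
    IsGradedMap (F.deg i) (G.deg i) φ t ∧ ∀ f, φ (F.d i f) ∈ LinearMap.range (G.d i)
  have step : ∀ i (φ : {φ // P i φ}), ∃ χ : {χ // P (i + 1) χ},
      ∀ f, G.d i (χ.1 f) = φ.1 (F.d i f) := by
    rintro i ⟨φ, hφ, hφr⟩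
    have hc := hφ.comp (F.isGradedMap_d i)
    rw [zero_add] at hc
    obtain ⟨χ, hχ, hχ'⟩ := (G.isGradedMap_d i).exists_lift hc hφr
    have key : ∀ f, G.d i (χ f) = φ (F.d i f) := fun f => LinearMap.congr_fun hχ' f
    refine ⟨⟨χ, hχ, fun f => ?_⟩, key⟩
    rw [← G.exact, LinearMap.mem_ker, key, F.d_d, map_zero]
  choose next hnext using step
  let φ : ∀ i, {φ // P i φ} := fun i => Nat.rec ⟨φ₀, h₀, hr⟩ next i
  exact ⟨fun i => (φ i).1, rfl, fun i => (φ i).2.1, fun i f => hnext i (φ i) f⟩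

/-- A graded endomorphism of complexes that vanishes on `F_0` is null-homotopic. -/
theorem exists_homotopy (F : QuotientResolution I)
    (φ : ∀ i, (F.B i →₀ 𝒮) →ₗ[𝒮] (F.B i →₀ 𝒮)) (h₀ : φ 0 = 0)
    (hφ : ∀ i, IsGradedMap (F.deg i) (F.deg i) (φ i) 0)
    (hc : ∀ i f, F.d i (φ (i + 1) f) = φ i (F.d i f)) :
    ∃ h : ∀ i, (F.B i →₀ 𝒮) →ₗ[𝒮] (F.B (i + 1) →₀ 𝒮), h 0 = 0 ∧
      (∀ i, IsGradedMap (F.deg i) (F.deg (i + 1)) (h i) 0) ∧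
      ∀ i f, φ (i + 1) f = F.d (i + 1) (h (i + 1) f) + h i (F.d i f) := by
  -- The second condition makes `φ (i + 1) - h ∘ d` land in the kernel of `F.d i`, so that it lifts
  -- through `F.d (i + 1)`.
  let P : ∀ i, ((F.B i →₀ 𝒮) →ₗ[𝒮] (F.B (i + 1) →₀ 𝒮)) → Prop := fun i h =>
    IsGradedMap (F.deg i) (F.deg (i + 1)) h 0 ∧ ∀ f, F.d i (h (F.d i f)) = φ i (F.d i f)
  have step : ∀ i (h : {h // P i h}), ∃ h' : {h' // P (i + 1) h'},
      ∀ f, φ (i + 1) f = F.d (i + 1) (h'.1 f) + h.1 (F.d i f) := by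
    rintro i ⟨h, hh, hhr⟩
    have hg : IsGradedMap (F.deg (i + 1)) (F.deg (i + 1)) (φ (i + 1) - h ∘ₗ F.d i) 0 := by
      have hc := hh.comp (F.isGradedMap_d i)
      rw [zero_add] at hc
      exact fun b => (hφ (i + 1) b).sub (hc b)
    obtain ⟨χ, hχ, hχ'⟩ := (F.isGradedMap_d (i + 1)).exists_lift hg fun f => by
      rw [← F.exact, LinearMap.mem_ker]
      simp [hc, hhr]
    have key : ∀ f, φ (i + 1) f = F.d (i + 1) (χ f) + h (F.d i f) := fun f => by
      have := LinearMap.congr_fun hχ' f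
      simp only [LinearMap.comp_apply, LinearMap.sub_apply] at this
      rw [this, sub_add_cancel]
    refine ⟨⟨χ, hχ, fun f => ?_⟩, key⟩
    have := key (F.d (i + 1) f)
    rw [F.d_d, map_zero, add_zero] at this
    exact this.symm
  choose next hnext using step
  let h : ∀ i, {h // P i h} := fun i => Nat.rec
    ⟨0, fun b => IsHomogElt.zero _ _, fun f => by simp [h₀]⟩ next i
  exact ⟨fun i => (h i).1, rfl, fun i => (h i).2.1, fun i f => hnext i (h i) f⟩

/-- Any two graded free resolutions of `S / I` are homotopy equivalent by graded maps. -/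
theorem exists_homotopyEquiv (F G : QuotientResolution I) :
    ∃ (φ : ∀ i, (F.B i →₀ 𝒮) →ₗ[𝒮] (G.B i →₀ 𝒮)) (ψ : ∀ i, (G.B i →₀ 𝒮) →ₗ[𝒮] (F.B i →₀ 𝒮))
      (h : ∀ i, (F.B i →₀ 𝒮) →ₗ[𝒮] (F.B (i + 1) →₀ 𝒮))
      (h' : ∀ i, (G.B i →₀ 𝒮) →ₗ[𝒮] (G.B (i + 1) →₀ 𝒮)),
      h 0 = 0 ∧ (∀ i, IsGradedMap (F.deg i) (G.deg i) (φ i) 0) ∧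
      (∀ i, IsGradedMap (G.deg i) (F.deg i) (ψ i) 0) ∧
      (∀ i, IsGradedMap (F.deg i) (F.deg (i + 1)) (h i) 0) ∧
      (∀ i f, G.d i (φ (i + 1) f) = φ i (F.d i f)) ∧
      (∀ i f, F.d i (ψ (i + 1) f) = ψ i (G.d i f)) ∧
      (∀ i f, ψ (i + 1) (φ (i + 1) f) - f = F.d (i + 1) (h (i + 1) f) + h i (F.d i f)) ∧
      ∀ i f, φ (i + 1) (ψ (i + 1) f) - f = G.d (i + 1) (h' (i + 1) f) + h' i (G.d i f) := by
  let := F.uniqueZero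
  let := G.uniqueZero
  let e : (F.B 0 →₀ 𝒮) ≃ₗ[𝒮] (G.B 0 →₀ 𝒮) :=
    Finsupp.domLCongr (Equiv.ofUnique (F.B 0) (G.B 0))
  have he : ∀ f b, e f b = f default := fun f b => by
    simp only [e, Finsupp.domLCongr_apply, Finsupp.domCongr_apply, Finsupp.equivMapDomain_apply]
    congr 1
  have he' : ∀ f b, e.symm f b = f default := fun f b => by
    obtain ⟨g, rfl⟩ := e.surjective f
    rw [e.symm_apply_apply, he]
    congr 1
    exact Subsingleton.elim _ _
  have hF : ∀ b, F.deg 0 b = 0 := F.deg_zero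
  have hG : ∀ b, G.deg 0 b = 0 := G.deg_zero
  have single_homog : ∀ {B C : Type u} [Unique B] [Unique C] (b : B)
      (deg : C → ℤ) (_ : ∀ c, deg c = 0) (g : C →₀ 𝒮)
      (_ : g default = (Finsupp.single b 1 : B →₀ 𝒮) default),
      IsHomogElt deg g (0 + 0) := by
    intro B C _ _ b deg hdeg g hg c
    rw [Subsingleton.elim c default, hg, Subsingleton.elim b default, Finsupp.single_eq_same, hdeg]
    simpa using IsHomogOfDegree.one
  obtain ⟨φ, hφ₀, hφ, hφc⟩ := exists_chainMap F G (t := 0) e.toLinearMap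
    (fun b => by rw [hF]; exact single_homog b _ hG _ (he _ _)) (fun f => by
      rw [G.mem_range_zero]
      intro b
      simp only [LinearEquiv.coe_coe, he]
      exact (F.mem_range_zero _).1 (LinearMap.mem_range_self _ _) _)
  obtain ⟨ψ, hψ₀, hψ, hψc⟩ := exists_chainMap G F (t := 0) e.symm.toLinearMap
    (fun b => by rw [hG]; exact single_homog b _ hF _ (he' _ _)) (fun f => by
      rw [F.mem_range_zero]
      intro b
      simp only [LinearEquiv.coe_coe, he']
      exact (G.mem_range_zero _).1 (LinearMap.mem_range_self _ _) _)
  -- On `F_0` and `G_0`, both a copy of `S` generated in degree zero, `φ` and `ψ` are mutually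
  -- inverse. So `ψ ∘ φ - id` vanishes there, and the homotopy can start with zero.
  obtain ⟨h, h0, hh, hhc⟩ := F.exists_homotopy (fun i => ψ i ∘ₗ φ i - LinearMap.id)
    (by ext; simp [hφ₀, hψ₀]) (fun i b => by
      have h1 := (hψ i).comp (hφ i)
      rw [add_zero] at h1
      exact (h1 b).sub (IsGradedMap.id b))
    (fun i f => by simp [hφc, hψc])
  obtain ⟨h', -, -, hhc'⟩ := G.exists_homotopy (fun i => φ i ∘ₗ ψ i - LinearMap.id)
    (by ext; simp [hφ₀, hψ₀]) (fun i b => by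
      have h1 := (hφ i).comp (hψ i)
      rw [add_zero] at h1
      exact (h1 b).sub (IsGradedMap.id b))
    (fun i f => by simp [hφc, hψc])
  exact ⟨φ, ψ, h, h', h0, hφ, hψ, hh, hφc, hψc, fun i f => by simpa using hhc i f,
    fun i f => by simpa using hhc' i f⟩

/-- A resolution is minimal if no entry of its differentials has a constant term. -/
def IsMinimal (G : QuotientResolution I) : Prop :=
  ∀ i b b', MvPolynomial.constantCoeff (G.d i (Finsupp.single b 1) b') = 0

end QuotientResolution

/-! ### Reduction modulo the variables. -/

section Reduction

variable {B C D : Type u}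

theorem reduceFree_add (f g : B →₀ 𝒮) : reduceFree (f + g) = reduceFree f + reduceFree g :=
  Finsupp.mapRange_add (map_add _) f g

theorem reduceFree_single (b : B) : reduceFree (Finsupp.single b (1 : 𝒮)) = Finsupp.single b 1 := by
  simp [reduceFree]

theorem reduceFree_smul (p : 𝒮) (f : B →₀ 𝒮) :
    reduceFree (p • f) = MvPolynomial.constantCoeff p • reduceFree f := by
  ext b; simp [reduceFree]

theorem reduceFree_surjective (f : B →₀ k) : ∃ g : B →₀ 𝒮, reduceFree g = f :=
  ⟨f.mapRange (MvPolynomial.C (σ := Fin n)) (map_zero _), by ext b; simp [reduceFree]⟩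

/-- The reduction of a linear map of free modules. -/
noncomputable def reduceMap (φ : (B →₀ 𝒮) →ₗ[𝒮] (C →₀ 𝒮)) : (B →₀ k) →ₗ[k] (C →₀ k) :=
  Finsupp.linearCombination k fun b => reduceFree (φ (Finsupp.single b 1))

theorem reduceMap_reduceFree (φ : (B →₀ 𝒮) →ₗ[𝒮] (C →₀ 𝒮)) (f : B →₀ 𝒮) :
    reduceMap φ (reduceFree f) = reduceFree (φ f) := by
  induction f using Finsupp.induction_linear with
  | zero => simp [reduceFree]
  | add f g hf hg => rw [reduceFree_add, map_add, map_add, reduceFree_add, hf, hg]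
  | single b p =>
    have h : Finsupp.single b p = p • Finsupp.single b (1 : 𝒮) := by simp
    rw [h, map_smul, reduceFree_smul, reduceFree_smul, map_smul, reduceFree_single]
    simp [reduceMap, Finsupp.linearCombination_single]

/-- A matrix entry between basis elements of different degrees is homogeneous of nonzero degree,
hence has no constant term. -/
theorem IsGradedMap.reduceMap_mem {degB : B → ℤ} {degC : C → ℤ} {φ : (B →₀ 𝒮) →ₗ[𝒮] (C →₀ 𝒮)}
    (hφ : IsGradedMap degB degC φ 0) {e : ℤ} {f : B →₀ k}
    (hf : f ∈ Finsupp.supported k k {b | degB b = e}) :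
    reduceMap φ f ∈ Finsupp.supported k k {c | degC c = e} := by
  rw [reduceMap, Finsupp.linearCombination_apply]
  refine Submodule.sum_mem _ fun b hb => Submodule.smul_mem _ _ fun c hc => ?_
  have hbe : degB b = e := hf hb
  by_contra hne
  simp only [Set.mem_ofPred_eq] at hne
  have h1 : reduceFree (φ (Finsupp.single b 1)) c ≠ 0 := by simpa using hc
  exact h1 ((hφ b c).constantCoeff_eq_zero (by rw [hbe]; omega))

theorem QuotientResolution.IsMinimal.reduceMap_d {I : Ideal (MvPolynomial (Fin n) k)}
    {G : QuotientResolution I} (hG : G.IsMinimal) (i : ℕ) : reduceMap (G.d i) = 0 := by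
  refine Finsupp.lhom_ext' fun b => LinearMap.ext_ring ?_
  ext c
  simpa [reduceMap, Finsupp.linearCombination_single, reduceFree] using hG i b c

theorem reduceFree_sub (f g : B →₀ 𝒮) : reduceFree (f - g) = reduceFree f - reduceFree g := by
  rw [eq_sub_iff_add_eq, ← reduceFree_add, sub_add_cancel]

/-- The comparison of a resolution with a minimal one, after reduction. -/
theorem QuotientResolution.IsMinimal.exists_reduced_comparison
    {I : Ideal (MvPolynomial (Fin n) k)} {G : QuotientResolution I} (hG : G.IsMinimal)
    (F : QuotientResolution I) (i : ℕ) :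
    ∃ (Φ : (F.B (i + 1) →₀ k) →ₗ[k] (G.B (i + 1) →₀ k))
      (Ψ : (G.B (i + 1) →₀ k) →ₗ[k] (F.B (i + 1) →₀ k))
      (H : (F.B (i + 1) →₀ k) →ₗ[k] (F.B (i + 2) →₀ k)),
      (∀ e, ∀ f ∈ Finsupp.supported k k {b | F.deg (i + 1) b = e},
        Φ f ∈ Finsupp.supported k k {b | G.deg (i + 1) b = e}) ∧
      (∀ e, ∀ f ∈ Finsupp.supported k k {b | G.deg (i + 1) b = e},
        Ψ f ∈ Finsupp.supported k k {b | F.deg (i + 1) b = e}) ∧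
      (∀ e, ∀ f ∈ Finsupp.supported k k {b | F.deg (i + 1) b = e},
        H f ∈ Finsupp.supported k k {b | F.deg (i + 2) b = e}) ∧
      (∀ f, Φ (reduceMap (F.d (i + 1)) f) = 0) ∧
      (∀ f, reduceMap (F.d i) (Ψ f) = 0) ∧
      (∀ f, (i ≠ 0 → reduceMap (F.d i) f = 0) → Ψ (Φ f) - f = reduceMap (F.d (i + 1)) (H f)) ∧
      ∀ f, Φ (Ψ f) = f := by
  obtain ⟨φ, ψ, h, h', h0, hφ, hψ, hh, hφc, hψc, hhc, hhc'⟩ := F.exists_homotopyEquiv G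
  refine ⟨reduceMap (φ (i + 1)), reduceMap (ψ (i + 1)), reduceMap (h (i + 1)),
    fun e f => (hφ _).reduceMap_mem, fun e f => (hψ _).reduceMap_mem,
    fun e f => (hh _).reduceMap_mem, fun f => ?_, fun f => ?_, fun f hf => ?_, fun f => ?_⟩ <;>
    obtain ⟨f, rfl⟩ := reduceFree_surjective (n := n) f
  · rw [reduceMap_reduceFree, reduceMap_reduceFree, ← hφc, ← reduceMap_reduceFree, hG.reduceMap_d,
      LinearMap.zero_apply]
  · rw [reduceMap_reduceFree, reduceMap_reduceFree, hψc, ← reduceMap_reduceFree,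
      ← reduceMap_reduceFree, hG.reduceMap_d, LinearMap.zero_apply, map_zero]
  · rw [reduceMap_reduceFree, reduceMap_reduceFree, ← reduceFree_sub, hhc, reduceFree_add,
      ← reduceMap_reduceFree, reduceMap_reduceFree _ f, add_eq_left, ← reduceMap_reduceFree,
      ← reduceMap_reduceFree]
    -- Index 1 here is homological degree 0 for the ideal, where every element is a cycle. No cycle
    -- condition is available, but the term is killed by `h 0 = 0`.
    rcases eq_or_ne i 0 with rfl | hi
    · have : reduceMap (0 : (F.B 0 →₀ 𝒮) →ₗ[𝒮] (F.B 1 →₀ 𝒮)) = 0 := by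
        ext; simp [reduceMap, reduceFree]
      rw [h0, this, LinearMap.zero_apply]
    · rw [hf hi, map_zero]
  -- By minimality the reduced differentials of `G` vanish, so the homotopy relation becomes an
  -- equality.
  · rw [reduceMap_reduceFree, reduceMap_reduceFree, ← sub_eq_zero, ← reduceFree_sub, hhc',
      reduceFree_add, ← reduceMap_reduceFree (G.d (i + 1)), hG.reduceMap_d,
      ← reduceMap_reduceFree (h' i), ← reduceMap_reduceFree (G.d i), hG.reduceMap_d, LinearMap.zero_apply, LinearMap.zero_apply, map_zero,
      add_zero]

end Reduction

namespace GradedFreeResolution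

variable {I : Ideal (MvPolynomial (Fin n) k)}

/-- The resolution of `S / I` that extends a resolution of `I`. -/
noncomputable def toQuotientResolution (F : GradedFreeResolution I) : QuotientResolution I where
  B := fun | 0 => PUnit | i + 1 => F.B i
  uniqueZero := inferInstanceAs (Unique PUnit)
  deg := fun | 0 => fun _ => 0 | i + 1 => F.deg i
  deg_zero _ := rfl
  d := fun
    | 0 => Finsupp.lsingle PUnit.unit ∘ₗ F.ε
    | i + 1 => F.d i
  isGradedMap_d := by
    rintro (_ | i) b b'
    · have h : (Finsupp.single PUnit.unit (F.ε (Finsupp.single b 1)) : PUnit →₀ 𝒮) b' =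
          F.ε (Finsupp.single b 1) := Finsupp.single_eq_same
      simpa [h] using F.homog_ε b
    · simpa using F.homog_d i b b'
  mem_range_zero f := by
    have hI : ∀ p, p ∈ I ↔ p ∈ LinearMap.range F.ε := fun p => iff_of_eq (by rw [F.range_ε])
    constructor
    · rintro ⟨g, rfl⟩ b
      have h : (Finsupp.single PUnit.unit (F.ε g) : PUnit →₀ 𝒮) b = F.ε g :=
        Finsupp.single_eq_same
      exact (congrArg (· ∈ I) h).mpr ((hI _).2 (LinearMap.mem_range_self _ _))
    · intro h
      obtain ⟨g, hg⟩ := (hI _).1 (h PUnit.unit)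
      refine ⟨g, ?_⟩
      change (Finsupp.single PUnit.unit (F.ε g) : PUnit →₀ 𝒮) = f
      rw [hg]
      exact (Finsupp.unique_single _).symm
  exact := by
    rintro (_ | i)
    · refine Eq.trans ?_ F.exact_zero
      exact LinearMap.ker_comp_of_ker_eq_bot _
        (LinearMap.ker_eq_bot.2 (Finsupp.single_injective PUnit.unit))
    · exact F.exact_succ i

end GradedFreeResolution

/-- The resolution of `I` that a resolution of `S / I` restricts to. -/
noncomputable def QuotientResolution.toGradedFreeResolution
    {I : Ideal (MvPolynomial (Fin n) k)} (G : QuotientResolution I) : GradedFreeResolution I :=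
  letI := G.uniqueZero
  { B := fun i => G.B (i + 1)
    deg := fun i => G.deg (i + 1)
    d := fun i => G.d (i + 1)
    ε := Finsupp.lapply default ∘ₗ G.d 0
    homog_d := fun i b b' => by simpa using G.isGradedMap_d (i + 1) b b'
    homog_ε := fun b => by simpa [G.deg_zero] using G.isGradedMap_d 0 b default
    range_ε := by
      ext p
      constructor
      · rintro ⟨g, rfl⟩
        exact (G.mem_range_zero _).1 (LinearMap.mem_range_self _ _) default
      · intro hp
        obtain ⟨g, hg⟩ := (G.mem_range_zero (Finsupp.single default p)).2 fun b => by
          rw [Subsingleton.elim b default, Finsupp.single_eq_same]; exact hp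
        exact ⟨g, by simp [hg, Finsupp.lapply_apply]⟩
    exact_zero := by
      rw [← G.exact 0]
      refine LinearMap.ker_comp_of_ker_eq_bot _ (LinearMap.ker_eq_bot.2 fun f g h => ?_)
      ext1
      exact h
    exact_succ := fun i => G.exact (i + 1) }

/-- First isomorphism theorem for the restriction of `Φ` to `Z`, whose kernel is `Z ∩ Y`. -/
theorem rank_subquotient_eq {V W : Type u} [AddCommGroup V] [Module k V] [AddCommGroup W]
    [Module k W] {Z Y : Submodule k V} {T : Submodule k W} (Φ : V →ₗ[k] W)
    (hmap : ∀ z ∈ Z, Φ z ∈ T) (hsurj : ∀ t ∈ T, ∃ z ∈ Z, Φ z = t)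
    (hker : ∀ z ∈ Z, Φ z = 0 ↔ z ∈ Y) :
    Module.rank k (Subquotient Z Y) = Module.rank k T := by
  let L : Z →ₗ[k] T := Φ.restrict hmap
  have hL : Function.Surjective L := fun ⟨t, ht⟩ => by
    obtain ⟨z, hz, rfl⟩ := hsurj t ht
    exact ⟨⟨z, hz⟩, rfl⟩
  have hL' : LinearMap.ker L = Y.submoduleOf Z := by
    ext ⟨z, hz⟩
    rw [LinearMap.mem_ker, ← Subtype.coe_inj]
    exact hker z hz
  exact ((Submodule.quotEquivOfEq _ _ hL'.symm).trans
    (LinearMap.quotKerEquivOfSurjective L hL)).rank_eq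

/-- A minimal resolution of `S / I` computes the dimension of `Tor_i(I, k)_e` for every graded free
resolution of `I`. -/
theorem GradedFreeResolution.rank_tor {I : Ideal (MvPolynomial (Fin n) k)}
    (F : GradedFreeResolution I) (G : QuotientResolution I) (hG : G.IsMinimal) (i : ℕ) (e : ℤ) :
    Module.rank k (F.Tor i e) = Cardinal.mk {b : G.B (i + 1) // G.deg (i + 1) b = e} := by
  obtain ⟨Φ, Ψ, H, hφ, hψ, hh, hΦd, hΨ', hΨΦ', hΦΨ⟩ :=
    hG.exists_reduced_comparison F.toQuotientResolution i
  -- Index `i + 1` of the resolution of `S / I` is by definition index `i` of the resolution of `I`.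
  change (F.B i →₀ k) →ₗ[k] (G.B (i + 1) →₀ k) at Φ
  change (G.B (i + 1) →₀ k) →ₗ[k] (F.B i →₀ k) at Ψ
  change (F.B i →₀ k) →ₗ[k] (F.B (i + 1) →₀ k) at H
  change ∀ f, Φ (F.dBar i f) = 0 at hΦd
  have hΨ : ∀ f, Ψ f ∈ F.cycles i := fun f => by
    rcases i with _ | i
    · trivial
    · exact hΨ' f
  have hΨΦ : ∀ f ∈ F.cycles i, Ψ (Φ f) - f = F.dBar i (H f) := fun f hf => by
    rcases i with _ | i
    · exact hΨΦ' f fun h => absurd rfl h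
    · exact hΨΦ' f fun _ => hf
  refine (rank_subquotient_eq (Z := F.cycles i ⊓ F.strand i e) (Y := F.boundaries i e)
    (T := Finsupp.supported k k {b | G.deg (i + 1) b = e}) Φ
    (fun f hf => hφ e f hf.2) (fun y hy => ⟨Ψ y, ⟨hΨ y, hψ e y hy⟩, hΦΨ y⟩) fun z hz => ?_).trans ?_
  · constructor
    · intro h0
      have h1 := hΨΦ z hz.1
      rw [h0, map_zero, zero_sub] at h1
      refine ⟨-H z, Submodule.neg_mem _ (hh e z hz.2), ?_⟩
      rw [map_neg, ← h1, neg_neg]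
    · rintro ⟨f, -, rfl⟩
      exact hΦd f
  · rw [(Finsupp.supportedEquivFinsupp (R := k) (M := k) _).rank_eq, rank_finsupp_self,
      Cardinal.lift_id]
    rfl

/-- If `S / I` has a minimal resolution, then the graded Betti numbers of `I` are the numbers of
basis elements. -/
theorem QuotientResolution.IsMinimal.hasGradedBetti {I : Ideal (MvPolynomial (Fin n) k)}
    {G : QuotientResolution I} (hG : G.IsMinimal) {i : ℕ} {e : ℤ} {β : ℕ}
    (h : Cardinal.mk {b : G.B (i + 1) // G.deg (i + 1) b = e} = β) : HasGradedBetti I i e β :=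
  ⟨⟨G.toGradedFreeResolution⟩, fun F => by rw [F.rank_tor G hG, h]⟩

end Comparison

/-! ### Mapping cones and minimality. -/

section Cone

variable {k : Type u} [Field k] {n : ℕ}

local notation "𝒮" => MvPolynomial (Fin n) k

section ConeMap

variable {A B C D : Type u}
  (p : (A →₀ MvPolynomial (Fin n) k) →ₗ[MvPolynomial (Fin n) k] (C →₀ MvPolynomial (Fin n) k))
  (q : (B →₀ MvPolynomial (Fin n) k) →ₗ[MvPolynomial (Fin n) k] (C →₀ MvPolynomial (Fin n) k))
  (r : (B →₀ MvPolynomial (Fin n) k) →ₗ[MvPolynomial (Fin n) k] (D →₀ MvPolynomial (Fin n) k))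

/-- The lowest differential of a mapping cone. -/
noncomputable def coneMapZero :
    (A ⊕ B →₀ MvPolynomial (Fin n) k) →ₗ[MvPolynomial (Fin n) k] (C →₀ MvPolynomial (Fin n) k) :=
  p.coprod q ∘ₗ (Finsupp.sumFinsuppLEquivProdFinsupp 𝒮).toLinearMap

/-- The differential of a mapping cone. -/
noncomputable def coneMap :
    (A ⊕ B →₀ MvPolynomial (Fin n) k) →ₗ[MvPolynomial (Fin n) k] (C ⊕ D →₀ MvPolynomial (Fin n) k) :=
  (Finsupp.sumFinsuppLEquivProdFinsupp 𝒮).symm.toLinearMap ∘ₗ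
    (p.coprod q).prod (-(r ∘ₗ LinearMap.snd 𝒮 _ _)) ∘ₗ
    (Finsupp.sumFinsuppLEquivProdFinsupp 𝒮).toLinearMap

theorem coneMapZero_inl (a : A) :
    coneMapZero p q (Finsupp.single (Sum.inl a) 1) = p (Finsupp.single a 1) := by
  simp [coneMapZero]

theorem coneMapZero_inr (b : B) :
    coneMapZero p q (Finsupp.single (Sum.inr b) 1) = q (Finsupp.single b 1) := by
  simp [coneMapZero]

theorem coneMap_inl_inl (a : A) (c : C) :
    coneMap p q r (Finsupp.single (Sum.inl a) 1) (Sum.inl c) = p (Finsupp.single a 1) c := by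
  simp [coneMap]

theorem coneMap_inl_inr (a : A) (d : D) :
    coneMap p q r (Finsupp.single (Sum.inl a) 1) (Sum.inr d) = 0 := by
  simp [coneMap]

theorem coneMap_inr_inl (b : B) (c : C) :
    coneMap p q r (Finsupp.single (Sum.inr b) 1) (Sum.inl c) = q (Finsupp.single b 1) c := by
  simp [coneMap]

theorem coneMap_inr_inr (b : B) (d : D) :
    coneMap p q r (Finsupp.single (Sum.inr b) 1) (Sum.inr d) = -r (Finsupp.single b 1) d := by
  simp [coneMap]

end ConeMap

namespace QuotientResolution

variable {I P : Ideal (MvPolynomial (Fin n) k)}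

/-- The mapping cone of a graded map `α : K(-t) → G` of resolutions, where `α` is injective on the
cokernels `S / P` and `S / I`. -/
noncomputable def cone (G : QuotientResolution I) (K : QuotientResolution P) {t : ℤ}
    (α : ∀ i, (K.B i →₀ MvPolynomial (Fin n) k) →ₗ[MvPolynomial (Fin n) k]
      (G.B i →₀ MvPolynomial (Fin n) k))
    (hα : ∀ i, IsGradedMap (K.deg i) (G.deg i) (α i) t)
    (hc : ∀ i f, G.d i (α (i + 1) f) = α i (K.d i f))
    (hinj : ∀ f, α 0 f ∈ LinearMap.range (G.d 0) → f ∈ LinearMap.range (K.d 0))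
    (J : Ideal (MvPolynomial (Fin n) k))
    (hJ : ∀ f, (∀ b, f b ∈ J) ↔ ∃ g, f - α 0 g ∈ LinearMap.range (G.d 0)) :
    QuotientResolution J where
  B := fun | 0 => G.B 0 | i + 1 => G.B (i + 1) ⊕ K.B i
  uniqueZero := G.uniqueZero
  deg := fun | 0 => G.deg 0 | i + 1 => Sum.elim (G.deg (i + 1)) fun b => K.deg i b + t
  deg_zero := G.deg_zero
  d := fun
    | 0 => coneMapZero (G.d 0) (α 0)
    | i + 1 => coneMap (G.d (i + 1)) (α (i + 1)) (K.d i)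
  isGradedMap_d := by
    have h : ∀ i, IsGradedMap (G.deg (i + 1)) (G.deg i) (G.d i) 0 := G.isGradedMap_d
    have h' : ∀ i, IsGradedMap (K.deg (i + 1)) (K.deg i) (K.d i) 0 := K.isGradedMap_d
    rintro (_ | i)
    · rintro (b | b) c
      · simpa [coneMapZero_inl] using h 0 b c
      · simpa [coneMapZero_inr] using hα 0 b c
    · rintro (b | b) (c | c)
      · simpa [coneMap_inl_inl] using h (i + 1) b c
      · simpa [coneMap_inl_inr] using IsHomogOfDegree.zero _
      · simpa [coneMap_inr_inl] using hα (i + 1) b c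
      · simpa [coneMap_inr_inr] using (h' i b c).neg
  mem_range_zero f := by
    refine Iff.trans ?_ (hJ f).symm
    constructor
    · rintro ⟨g, rfl⟩
      refine ⟨(Finsupp.sumFinsuppLEquivProdFinsupp 𝒮 g).2,
        (Finsupp.sumFinsuppLEquivProdFinsupp 𝒮 g).1, ?_⟩
      simp [coneMapZero]
    · rintro ⟨g, f', hf'⟩
      refine ⟨(Finsupp.sumFinsuppLEquivProdFinsupp 𝒮).symm (f', g), ?_⟩
      simp [coneMapZero, hf']
  exact := by
    -- A cycle `(g, κ)` of the cone is a boundary as soon as `κ` is in the range of `K.d i`. In the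
    -- lowest degree this comes from injectivity on cokernels, above it from exactness of `K`.
    have key : ∀ i (g : G.B (i + 1) →₀ 𝒮) (κ : K.B i →₀ 𝒮), G.d i g + α i κ = 0 →
        κ ∈ LinearMap.range (K.d i) →
        ∃ g' κ', G.d (i + 1) g' + α (i + 1) κ' = g ∧ -(K.d i κ') = κ := by
      rintro i g _ h ⟨κ, rfl⟩
      rw [← hc, ← map_add, ← LinearMap.mem_ker, G.exact] at h
      obtain ⟨g', hg'⟩ := h
      exact ⟨g', -κ, by simp [hg'], by simp⟩
    rintro (_ | i)
    · ext f
      obtain ⟨⟨g, κ⟩, rfl⟩ := (Finsupp.sumFinsuppLEquivProdFinsupp 𝒮).symm.surjective f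
      simp only [coneMapZero, coneMap, LinearMap.mem_ker, LinearMap.comp_apply, LinearEquiv.coe_coe,
        LinearEquiv.apply_symm_apply, LinearMap.coprod_apply]
      constructor
      · intro h
        obtain ⟨g', κ', h1, h2⟩ := key 0 g κ h (hinj _ ⟨-g, by
          rw [map_neg, neg_eq_iff_add_eq_zero]; exact h⟩)
        refine ⟨(Finsupp.sumFinsuppLEquivProdFinsupp 𝒮).symm (g', κ'), ?_⟩
        simp [← h1, ← h2]
      · rintro ⟨f, hf⟩
        obtain ⟨⟨g', κ'⟩, rfl⟩ := (Finsupp.sumFinsuppLEquivProdFinsupp 𝒮).symm.surjective f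
        simp only [LinearMap.comp_apply, LinearEquiv.coe_coe,
          LinearEquiv.apply_symm_apply, EmbeddingLike.apply_eq_iff_eq, LinearMap.prod_apply,
          LinearMap.coprod_apply, Function.prod, Prod.mk.injEq, LinearMap.neg_apply,
          LinearMap.snd_apply] at hf
        rw [← hf.1, ← hf.2, map_add, G.d_d, hc]
        simp
    · ext f
      obtain ⟨⟨g, κ⟩, rfl⟩ := (Finsupp.sumFinsuppLEquivProdFinsupp 𝒮).symm.surjective f
      simp only [coneMap, LinearMap.mem_ker, LinearMap.comp_apply, LinearEquiv.coe_coe,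
        LinearEquiv.apply_symm_apply, LinearEquiv.map_eq_zero_iff, LinearMap.prod_apply,
        LinearMap.coprod_apply, Function.prod, Prod.mk_eq_zero, LinearMap.neg_apply, neg_eq_zero,
        LinearMap.snd_apply]
      constructor
      · rintro ⟨h, h'⟩
        rw [← LinearMap.mem_ker, K.exact] at h'
        obtain ⟨g', κ', h1, h2⟩ := key (i + 1) g κ h h'
        refine ⟨(Finsupp.sumFinsuppLEquivProdFinsupp 𝒮).symm (g', κ'), ?_⟩
        simp [← h1, ← h2]
      · rintro ⟨f, hf⟩
        obtain ⟨⟨g', κ'⟩, rfl⟩ := (Finsupp.sumFinsuppLEquivProdFinsupp 𝒮).symm.surjective f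
        simp only [LinearMap.comp_apply, LinearEquiv.coe_coe,
          LinearEquiv.apply_symm_apply, EmbeddingLike.apply_eq_iff_eq, LinearMap.prod_apply,
          LinearMap.coprod_apply, Function.prod, Prod.mk.injEq, LinearMap.neg_apply,
          LinearMap.snd_apply] at hf
        rw [← hf.1, ← hf.2, map_add, G.d_d, hc, map_neg, map_neg, K.d_d]
        simp

end QuotientResolution

/-- `S / I` has a minimal graded free resolution, with `F_0 = S`, in which `F_i` has `β i e` basis
elements of degree `e`. -/
def HasMinimalResolution (I : Ideal (MvPolynomial (Fin n) k)) (β : ℕ → ℤ → ℕ) : Prop :=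
  ∃ G : QuotientResolution I, G.IsMinimal ∧
    ∀ i e, Cardinal.mk {b : G.B i // G.deg i b = e} = β i e

theorem HasMinimalResolution.hasGradedBetti {I : Ideal (MvPolynomial (Fin n) k)} {β : ℕ → ℤ → ℕ}
    (h : HasMinimalResolution I β) (i : ℕ) (e : ℤ) : HasGradedBetti I i e (β (i + 1) e) := by
  obtain ⟨G, hG, hβ⟩ := h
  exact hG.hasGradedBetti (hβ _ _)

/-- The Betti numbers of `S / (I + (u))`, from those of `S / I` and `S / P`, where `P = I : u`. -/
def coneBetti (β γ : ℕ → ℤ → ℕ) (t : ℤ) : ℕ → ℤ → ℕ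
  | 0, e => β 0 e
  | i + 1, e => β (i + 1) e + γ i (e - t)

/-- The mapping cone of the multiplication by `u` on `S / (I : u)`, if it is minimal for degree
reasons. -/
theorem HasMinimalResolution.cone {I P : Ideal (MvPolynomial (Fin n) k)} {β γ : ℕ → ℤ → ℕ}
    (hI : HasMinimalResolution I β) (hP : HasMinimalResolution P γ) {u : 𝒮} {t : ℤ}
    (hu : IsHomogOfDegree u t) (hcolon : ∀ p, u * p ∈ I ↔ p ∈ P)
    (hβγ : ∀ i e, γ i (e - t) ≠ 0 → β i e = 0) :
    HasMinimalResolution (I ⊔ Ideal.span {u}) (coneBetti β γ t) := by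
  obtain ⟨G, hG, hβ⟩ := hI
  obtain ⟨K, hK, hγ⟩ := hP
  let := G.uniqueZero
  let := K.uniqueZero
  let α₀ : (K.B 0 →₀ 𝒮) →ₗ[𝒮] (G.B 0 →₀ 𝒮) :=
    u • (Finsupp.domLCongr (Equiv.ofUnique (K.B 0) (G.B 0))).toLinearMap
  have hα₀ : ∀ f b, α₀ f b = u * f default := fun f b => by
    simp only [α₀, LinearMap.smul_apply, LinearEquiv.coe_coe, Finsupp.domLCongr_apply,
      Finsupp.domCongr_apply, Finsupp.smul_apply, Finsupp.equivMapDomain_apply, smul_eq_mul]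
    congr 1
  -- Multiplication by `u` from `S / P` to `S / I` is well defined and injective because `I : u =
  -- P`.
  have hmem : ∀ f, α₀ f ∈ LinearMap.range (G.d 0) ↔ f ∈ LinearMap.range (K.d 0) := fun f => by
    rw [G.mem_range_zero, K.mem_range_zero]
    simp only [hα₀, hcolon]
    exact ⟨fun h b => by rw [Subsingleton.elim b default]; exact h default, fun h _ => h _⟩
  obtain ⟨α, h0, hα, hc⟩ := K.exists_chainMap G (t := t) α₀
    (fun b c => by
      rw [hα₀, Subsingleton.elim b default, Finsupp.single_eq_same, mul_one, K.deg_zero, G.deg_zero]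
      simpa using hu)
    (fun f => (hmem _).2 (LinearMap.mem_range_self _ _))
  have hJ : ∀ f : G.B 0 →₀ 𝒮, (∀ b, f b ∈ I ⊔ Ideal.span {u}) ↔
      ∃ g, f - α 0 g ∈ LinearMap.range (G.d 0) := fun f => by
    simp only [G.mem_range_zero, h0, Finsupp.sub_apply, hα₀]
    constructor
    · intro h
      obtain ⟨p, hp, q, hq, hpq⟩ := Submodule.mem_sup.1 (h default)
      obtain ⟨r, rfl⟩ := Ideal.mem_span_singleton'.1 hq
      refine ⟨Finsupp.single default r, fun b => ?_⟩
      rw [Subsingleton.elim b default, Finsupp.single_eq_same, ← hpq, mul_comm u, add_sub_cancel_right]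
      exact hp
    · rintro ⟨g, hg⟩ b
      rw [← sub_add_cancel (f b) (u * g default)]
      exact add_mem (Ideal.mem_sup_left (hg b))
        (Ideal.mem_sup_right (Ideal.mul_mem_right _ _ (Ideal.mem_span_singleton_self u)))
  -- A constant entry would force the degree of `c` to be that of `b` plus `t`; the hypothesis on
  -- `β` and `γ` says that no such pair exists.
  have hmin : ∀ i b c, MvPolynomial.constantCoeff (α i (Finsupp.single b 1) c) = 0 := by
    intro i b c
    refine (hα i b c).constantCoeff_eq_zero fun h => ?_
    have h1 : γ i (G.deg i c - t) ≠ 0 := fun h0 => by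
      have h2 := hγ i (G.deg i c - t)
      rw [h0, Nat.cast_zero, Cardinal.mk_eq_zero_iff] at h2
      exact h2.elim ⟨b, by omega⟩
    have h2 := hβ i (G.deg i c)
    rw [hβγ _ _ h1, Nat.cast_zero, Cardinal.mk_eq_zero_iff] at h2
    exact h2.elim ⟨c, rfl⟩
  refine ⟨G.cone K α hα hc (fun f hf => ?_) _ hJ, ?_, ?_⟩
  · rw [h0] at hf
    exact (hmem f).1 hf
  · rintro (_ | i)
    · rintro (b | b) c
      · exact (congrArg (fun f => MvPolynomial.constantCoeff (f c))
          (coneMapZero_inl (G.d 0) (α 0) b)).trans (hG 0 b c)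
      · exact (congrArg (fun f => MvPolynomial.constantCoeff (f c))
          (coneMapZero_inr (G.d 0) (α 0) b)).trans (hmin 0 b c)
    · rintro (b | b) (c | c)
      · exact (congrArg MvPolynomial.constantCoeff (coneMap_inl_inl (G.d (i + 1)) (α (i + 1))
          (K.d i) b c)).trans (hG (i + 1) b c)
      · exact (congrArg MvPolynomial.constantCoeff (coneMap_inl_inr (G.d (i + 1)) (α (i + 1))
          (K.d i) b c)).trans (map_zero _)
      · exact (congrArg MvPolynomial.constantCoeff (coneMap_inr_inl (G.d (i + 1)) (α (i + 1))
          (K.d i) b c)).trans (hmin (i + 1) b c)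
      · refine (congrArg MvPolynomial.constantCoeff (coneMap_inr_inr (G.d (i + 1)) (α (i + 1))
          (K.d i) b c)).trans ?_
        rw [map_neg, hK i b c, neg_zero]
  · rintro (_ | i) e
    · exact hβ 0 e
    · rw [coneBetti, Nat.cast_add, ← hβ, ← hγ, Cardinal.add_def]
      refine Cardinal.mk_congr (Equiv.subtypeSum.trans (Equiv.sumCongr (Equiv.refl _) ?_))
      exact Equiv.subtypeEquivRight fun b => (eq_sub_iff_add_eq).symm

/-- The Betti numbers of `S`. -/
def botBetti : ℕ → ℤ → ℕ
  | 0, e => if e = 0 then 1 else 0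
  | _ + 1, _ => 0

theorem hasMinimalResolution_bot :
    HasMinimalResolution (⊥ : Ideal (MvPolynomial (Fin n) k)) botBetti := by
  let G : QuotientResolution (⊥ : Ideal (MvPolynomial (Fin n) k)) :=
    { B := fun | 0 => PUnit | _ + 1 => PEmpty
      uniqueZero := inferInstanceAs (Unique PUnit)
      deg := fun | 0 => 0 | _ + 1 => 0
      deg_zero := fun _ => rfl
      d := fun _ => 0
      isGradedMap_d := fun _ _ => IsHomogElt.zero _ _
      mem_range_zero := fun f => by simp [Finsupp.ext_iff, eq_comm]
      exact := fun i => by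
        ext f
        rw [Subsingleton.elim (α := PEmpty.{u + 1} →₀ 𝒮) f 0]
        simp }
  refine ⟨G, fun i b b' => by simp [G], ?_⟩
  rintro (_ | i) e
  · rcases eq_or_ne e 0 with rfl | he
    · refine (Cardinal.mk_congr (Equiv.subtypeUnivEquiv fun _ => rfl)).trans ?_
      exact (Cardinal.mk_punit).trans (by simp [botBetti])
    · rw [botBetti, if_neg he, Nat.cast_zero, Cardinal.mk_eq_zero_iff]
      exact ⟨fun b => he b.2.symm⟩
  · rw [botBetti, Nat.cast_zero, Cardinal.mk_eq_zero_iff]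
    exact ⟨fun b => PEmpty.elim b.1⟩

end Cone

/-! ### Koszul complexes and linear quotients. -/

section LinearQuotients

variable {k : Type u} [Field k] {n : ℕ}

local notation "𝒮" => MvPolynomial (Fin n) k

theorem forall_mem_support_monomial_mul (u : Fin n →₀ ℕ) (p : 𝒮) (Q : (Fin n →₀ ℕ) → Prop) :
    (∀ m ∈ (MvPolynomial.monomial u 1 * p).support, Q m) ↔ ∀ m ∈ p.support, Q (u + m) := by
  simp only [MvPolynomial.mem_support_iff]
  constructor
  · intro h m hm
    refine h _ ?_
    rwa [MvPolynomial.coeff_monomial_mul, one_mul]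
  · intro h m hm
    rw [MvPolynomial.coeff_monomial_mul'] at hm
    split_ifs at hm with hu
    · rw [one_mul] at hm
      have := h _ hm
      rwa [add_tsub_cancel_of_le hu] at this
    · exact absurd rfl hm

theorem mem_varIdeal_iff (A : Finset (Fin n)) (p : 𝒮) :
    p ∈ varIdeal k n A ↔ ∀ m ∈ p.support, ∃ a ∈ A, m a ≠ 0 := by
  rw [varIdeal, MvPolynomial.mem_ideal_span_X_image]
  rfl

/-- The Betti numbers of `S / (x_a : a ∈ A)` with `|A| = r`. -/
def koszulBetti (r i : ℕ) (e : ℤ) : ℕ :=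
  if e = i then r.choose i else 0

/-- The Koszul complex, built one variable at a time: a new variable is a nonzerodivisor modulo the
others, so the colon ideal is unchanged and Pascal's rule adds the Betti numbers. -/
theorem hasMinimalResolution_varIdeal (A : Finset (Fin n)) :
    HasMinimalResolution (varIdeal k n A) (koszulBetti A.card) := by
  classical
  induction A using Finset.induction_on with
  | empty =>
    have h1 : varIdeal k n ∅ = ⊥ := by simp [varIdeal]
    have h2 : koszulBetti (∅ : Finset (Fin n)).card = botBetti := by
      funext i e
      rcases i with _ | i <;> simp [koszulBetti, botBetti]
    rw [h1, h2]
    exact hasMinimalResolution_bot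
  | insert b A hb ih =>
    have h1 : varIdeal k n (insert b A) = varIdeal k n A ⊔ Ideal.span {MvPolynomial.X b} := by
      simp [varIdeal, Set.image_insert_eq, Ideal.span_insert, sup_comm]
    have h2 : koszulBetti (insert b A).card = coneBetti (koszulBetti A.card) (koszulBetti A.card) 1 := by
      funext i e
      rw [Finset.card_insert_of_notMem hb]
      rcases i with _ | i
      · simp [koszulBetti, coneBetti]
      · simp only [koszulBetti, coneBetti, Nat.cast_add, Nat.cast_one, sub_eq_iff_eq_add]
        split_ifs
        · rw [Nat.choose_succ_succ, add_comm]
        · rfl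
    rw [h1, h2]
    refine ih.cone ih (u := MvPolynomial.X b) ?_ (fun p => ?_) fun i e h => ?_
    · have := IsHomogOfDegree.monomial (k := k) (Finsupp.single b 1) 1
      rwa [Finsupp.degree_single, Nat.cast_one] at this
    · rw [mem_varIdeal_iff, mem_varIdeal_iff]
      refine (forall_mem_support_monomial_mul (Finsupp.single b 1) p _).trans ?_
      refine forall₂_congr fun m _ => exists_congr fun a => and_congr_right fun ha => ?_
      have : a ≠ b := fun h => hb (h ▸ ha)
      simp [this.symm]
    · simp only [koszulBetti] at h ⊢
      rw [if_neg]
      rintro rfl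
      simp at h

/-- The ideal generated by the monomials with exponents in `T`. -/
noncomputable def monomialIdeal (k : Type u) [Field k] {n : ℕ} (T : Set (Fin n →₀ ℕ)) :
    Ideal (MvPolynomial (Fin n) k) :=
  Ideal.span ((fun m => MvPolynomial.monomial m 1) '' T)

theorem mem_monomialIdeal_iff (T : Set (Fin n →₀ ℕ)) (p : 𝒮) :
    p ∈ monomialIdeal k T ↔ ∀ m ∈ p.support, ∃ g ∈ T, g ≤ m :=
  MvPolynomial.mem_ideal_span_monomial_image

/-- The Betti numbers of `S / I`, if the ideal `I` has linear quotients with respect to generators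
`g j` and the successive colon ideals are generated by sets `A j` of variables. -/
noncomputable def linearQuotientBetti {ι : Type*} (g : ι → Fin n →₀ ℕ) (A : ι → Finset (Fin n)) (s : Finset ι) :
    ℕ → ℤ → ℕ
  | 0, e => if e = 0 then 1 else 0
  | i + 1, e => ∑ j ∈ s, if ((g j).degree : ℤ) + i = e then (A j).card.choose i else 0

/-- Monomial ideals with linear quotients have the expected Betti numbers. -/
theorem hasMinimalResolution_of_linearQuotients {ι : Type*} (g : ι → Fin n →₀ ℕ)
    (A : ι → Finset (Fin n)) (ρ : ι → ℕ) (s : Finset ι)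
    (hdeg : ∀ i ∈ s, ∀ j ∈ s, ρ j ≤ ρ i → (g j).degree ≤ (g i).degree)
    (hpos : ∀ i ∈ s, (g i).degree ≠ 0)
    (hA : ∀ i ∈ s, ∀ a ∈ A i, ∃ j ∈ s, ρ j < ρ i ∧ g j ≤ g i + Finsupp.single a 1)
    (hg : ∀ i ∈ s, ∀ j ∈ s, j ≠ i → ρ j ≤ ρ i → ∃ a ∈ A i, g i a < g j a) :
    HasMinimalResolution (monomialIdeal k (g '' s)) (linearQuotientBetti g A s) := by
  classical
  -- The last generator is any one of largest `ρ`, ties being broken arbitrarily. Hence `hg` covers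
  -- `ρ j ≤ ρ i`, while the strict inequality in `hA` guarantees that its witness was added before.
  induction s using Finset.induction_on_max_value ρ with
  | empty =>
    have h1 : monomialIdeal k (g '' ((∅ : Finset ι) : Set ι)) = ⊥ := by simp [monomialIdeal]
    have h2 : linearQuotientBetti g A ∅ = botBetti := by
      funext i e
      rcases i with _ | i <;> simp [linearQuotientBetti, botBetti]
    rw [h1, h2]
    exact hasMinimalResolution_bot
  | insert a s ha hmax ih =>
    have hs : ∀ i ∈ s, i ∈ insert a s := fun i => Finset.mem_insert_of_mem
    have has := Finset.mem_insert_self a s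
    have IH := ih (fun i hi j hj => hdeg i (hs i hi) j (hs j hj)) (fun i hi => hpos i (hs i hi))
      (fun i hi b hb => by
        obtain ⟨j, hj, hlt, hle⟩ := hA i (hs i hi) b hb
        refine ⟨j, (Finset.mem_insert.1 hj).resolve_left ?_, hlt, hle⟩
        rintro rfl
        exact absurd (hmax i hi) (not_le.2 hlt))
      (fun i hi j hj => hg i (hs i hi) j (hs j hj))
    have h1 : monomialIdeal k (g '' ((insert a s : Finset ι) : Set ι)) =
        monomialIdeal k (g '' s) ⊔ Ideal.span {MvPolynomial.monomial (g a) 1} := by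
      rw [Finset.coe_insert, monomialIdeal, Set.image_insert_eq, Set.image_insert_eq,
        Ideal.span_insert, sup_comm]
      rfl
    have h2 : linearQuotientBetti g A (insert a s) =
        coneBetti (linearQuotientBetti g A s) (koszulBetti (A a).card) (g a).degree := by
      funext i e
      rcases i with _ | i
      · rfl
      · simp only [linearQuotientBetti, coneBetti, koszulBetti, Finset.sum_insert ha]
        rw [add_comm]
        congr 1
        refine if_congr ?_ rfl rfl
        constructor <;> intro h <;> omega
    rw [h1, h2]
    refine IH.cone (hasMinimalResolution_varIdeal (A a)) (IsHomogOfDegree.monomial _ _)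
      (fun p => ?_) fun i e h => ?_
    · rw [mem_monomialIdeal_iff, mem_varIdeal_iff, forall_mem_support_monomial_mul]
      refine forall₂_congr fun m _ => ?_
      constructor
      · rintro ⟨_, ⟨j, hj, rfl⟩, hle⟩
        have hja : j ≠ a := fun h => ha (h ▸ hj)
        obtain ⟨b, hb, hlt⟩ := hg a has j (hs j hj) hja (hmax j hj)
        refine ⟨b, hb, fun h0 => ?_⟩
        have := hle b
        rw [Finsupp.add_apply, h0] at this
        omega
      · rintro ⟨b, hb, hmb⟩
        obtain ⟨j, hj, hlt, hle⟩ := hA a has b hb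
        refine ⟨g j, ⟨j, (Finset.mem_insert.1 hj).resolve_left ?_, rfl⟩, hle.trans ?_⟩
        · rintro rfl
          exact lt_irrefl _ hlt
        · refine add_le_add le_rfl ?_
          rw [Finsupp.single_le_iff]
          omega
    -- The shifted Koszul basis in homological degree `i` has degree `i + deg g_a`. The old basis
    -- has degree `deg g_j + i - 1`, which is smaller, if `i > 0`, and degree `0 < deg g_a` if `i =
    -- 0`.
    · have he : e = i + (g a).degree := by
        by_contra hne
        refine h (if_neg fun h' => hne ?_)
        omega
      have hpa := hpos a has
      rcases i with _ | i
      · refine if_neg ?_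
        omega
      · refine Finset.sum_eq_zero fun j hj => if_neg ?_
        have := hdeg a has j (hs j hj) (hmax j hj)
        push_cast at he
        omega

end LinearQuotients

/-! ### Generators of the symbolic cube and their linear quotients. -/

section StarGenerators

variable {k : Type u} [Field k] {n : ℕ}

local notation "𝒮" => MvPolynomial (Fin n) k

theorem monomial_mem_varIdeal_pow (A : Finset (Fin n)) (r : ℕ) (m : Fin n →₀ ℕ) (x : k)
    (h : r ≤ ∑ a ∈ A, m a) : MvPolynomial.monomial m x ∈ varIdeal k n A ^ r := by
  classical
  induction r generalizing m with
  | zero => simp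
  | succ r ih =>
    obtain ⟨a, ha, hma⟩ : ∃ a ∈ A, m a ≠ 0 := by
      by_contra! h0
      rw [Finset.sum_eq_zero h0] at h
      omega
    have hle : Finsupp.single a 1 ≤ m := by
      rw [Finsupp.single_le_iff]; omega
    obtain ⟨m', rfl⟩ := exists_add_of_le hle
    have hsum : ∑ b ∈ A, (Finsupp.single a 1 + m' : Fin n →₀ ℕ) b = 1 + ∑ b ∈ A, m' b := by
      simp [Finsupp.add_apply, Finset.sum_add_distrib, Finsupp.single_apply, ha]
    rw [add_comm (Finsupp.single a 1), ← mul_one x, ← MvPolynomial.monomial_mul, pow_succ]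
    exact Ideal.mul_mem_mul (ih _ (by omega)) (Ideal.subset_span ⟨a, ha, rfl⟩)

/-- The degree in the variables of `A` is additive on monomials, and a monomial of `A`-degree at
least `r` can be stripped of `r` such variables one by one. -/
theorem mem_varIdeal_pow_iff (A : Finset (Fin n)) (r : ℕ) (p : 𝒮) :
    p ∈ varIdeal k n A ^ r ↔ ∀ m ∈ p.support, r ≤ ∑ a ∈ A, m a := by
  classical
  constructor
  · intro hp
    induction r generalizing p with
    | zero => simp
    | succ r ih =>
      rw [pow_succ] at hp
      induction hp using Submodule.mul_induction_on' with
      | mem_mul_mem p hp q hq =>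
        intro m hm
        obtain ⟨a, ha, b, hb, rfl⟩ := Finset.mem_add.1 (MvPolynomial.support_mul p q hm)
        obtain ⟨c, hc, hbc⟩ := (mem_varIdeal_iff A q).1 hq b hb
        have h1 := ih p hp a ha
        have h2 := Finset.single_le_sum (f := fun a => b a) (fun _ _ => Nat.zero_le _) hc
        simp only [Finsupp.add_apply, Finset.sum_add_distrib]
        omega
      | add p _ q _ hp hq =>
        intro m hm
        rcases Finset.mem_union.1 (MvPolynomial.support_add hm) with h | h
        exacts [hp m h, hq m h]
  · intro h
    rw [← MvPolynomial.support_sum_monomial_coeff p]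
    exact sum_mem fun m hm => monomial_mem_varIdeal_pow A r m _ (h m hm)

theorem mem_starSymbolicPower_iff (c r : ℕ) (p : 𝒮) :
    p ∈ starSymbolicPower k n c r ↔
      ∀ m ∈ p.support, ∀ A : Finset (Fin n), A.card = c → r ≤ ∑ a ∈ A, m a := by
  simp only [starSymbolicPower, Submodule.mem_iInf, Subtype.forall, mem_varIdeal_pow_iff]
  exact ⟨fun h m hm A hA => h A hA m hm, fun h A hA m hm => h m hm A hA⟩

/-- The index type of the generators of the symbolic cube: squarefree monomials `x_T`, monomials
`x_W ^ 2 / x_w` with `w ∈ W`, and cubes `x_W ^ 3`. -/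
abbrev CubeIndex (n : ℕ) : Type := Finset (Fin n) ⊕ (Finset (Fin n) × Fin n) ⊕ Finset (Fin n)

open Classical in
/-- The exponents of the generators. -/
noncomputable def cubeExponent : CubeIndex n → Fin n →₀ ℕ
  | .inl T => Finsupp.equivFunOnFinite.symm fun a => if a ∈ T then 1 else 0
  | .inr (.inl (W, w)) =>
      Finsupp.equivFunOnFinite.symm fun a => if a = w then 1 else if a ∈ W then 2 else 0
  | .inr (.inr W) => Finsupp.equivFunOnFinite.symm fun a => if a ∈ W then 3 else 0

open Classical in
/-- The variables that generate the successive colon ideals. -/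
noncomputable def cubeColon : CubeIndex n → Finset (Fin n)
  | .inl T => {a | a ∉ T ∧ ∃ b ∈ T, a < b}
  | .inr (.inl (W, w)) => {a | a ∉ W ∨ a = w ∧ ∃ b ∈ W, b < w}
  | .inr (.inr W) => Wᶜ

open Classical in
/-- The order in which the generators are added. -/
noncomputable def cubeRank : CubeIndex n → ℕ
  | .inl T => T.sup fun a => (a : ℕ)
  | .inr (.inl (W, w)) => if ∃ b ∈ W, b < w then n + 1 else n
  | .inr (.inr _) => n + 2

open Classical in
/-- The generators of the symbolic cube of `I_{n,n-m}`. -/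
noncomputable def cubeGenerators (n m : ℕ) : Finset (CubeIndex n) :=
  (Finset.powersetCard (m + 3) Finset.univ).disjSum
    (((Finset.powersetCard (m + 2) Finset.univ ×ˢ Finset.univ).filter fun p => p.2 ∈ p.1).disjSum
      (Finset.powersetCard (m + 1) Finset.univ))

theorem inl_mem_cubeGenerators {m : ℕ} {T : Finset (Fin n)} :
    (.inl T : CubeIndex n) ∈ cubeGenerators n m ↔ T.card = m + 3 := by
  simp [cubeGenerators]

theorem inr_inl_mem_cubeGenerators {m : ℕ} {W : Finset (Fin n)} {w : Fin n} :
    (.inr (.inl (W, w)) : CubeIndex n) ∈ cubeGenerators n m ↔ W.card = m + 2 ∧ w ∈ W := by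
  simp [cubeGenerators]

theorem inr_inr_mem_cubeGenerators {m : ℕ} {W : Finset (Fin n)} :
    (.inr (.inr W) : CubeIndex n) ∈ cubeGenerators n m ↔ W.card = m + 1 := by
  simp [cubeGenerators]

theorem forall_mem_cubeGenerators {m : ℕ} {Q : CubeIndex n → Prop} :
    (∀ i ∈ cubeGenerators n m, Q i) ↔ (∀ T : Finset (Fin n), T.card = m + 3 → Q (.inl T)) ∧
      (∀ (W : Finset (Fin n)) (w : Fin n), W.card = m + 2 → w ∈ W → Q (.inr (.inl (W, w)))) ∧
      ∀ W : Finset (Fin n), W.card = m + 1 → Q (.inr (.inr W)) := by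
  constructor
  · intro h
    exact ⟨fun T hT => h _ (inl_mem_cubeGenerators.2 hT),
      fun W w hW hw => h _ (inr_inl_mem_cubeGenerators.2 ⟨hW, hw⟩),
      fun W hW => h _ (inr_inr_mem_cubeGenerators.2 hW)⟩
  · rintro ⟨h1, h2, h3⟩ (T | ⟨W, w⟩ | W) hi
    · exact h1 T (inl_mem_cubeGenerators.1 hi)
    · exact h2 W w (inr_inl_mem_cubeGenerators.1 hi).1 (inr_inl_mem_cubeGenerators.1 hi).2
    · exact h3 W (inr_inr_mem_cubeGenerators.1 hi)

theorem degree_cubeExponent_inl (T : Finset (Fin n)) :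
    (cubeExponent (.inl T)).degree = T.card := by
  simp [cubeExponent, Finsupp.degree_eq_sum]

/-- Restoring the missing factor `x_w` gives `x_W ^ 2`; stated additively to avoid truncated
subtraction. -/
theorem sum_cubeExponent_inr_inl {W : Finset (Fin n)} {w : Fin n} (hw : w ∈ W)
    (A : Finset (Fin n)) :
    ∑ a ∈ A, cubeExponent (.inr (.inl (W, w))) a + (if w ∈ A then 1 else 0) =
      2 * (A ∩ W).card := by
  classical
  rw [← Finset.sum_ite_eq' A w (fun _ => 1), ← Finset.sum_add_distrib, Finset.card_eq_sum_ones,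
    Finset.mul_sum, ← Finset.sum_ite_mem]
  refine Finset.sum_congr rfl fun a _ => ?_
  simp only [cubeExponent, Finsupp.equivFunOnFinite_symm_apply_apply]
  by_cases h : a = w
  · simp [h, hw]
  · simp [h]

theorem degree_cubeExponent_inr_inl {W : Finset (Fin n)} {w : Fin n} (hw : w ∈ W) :
    (cubeExponent (.inr (.inl (W, w)))).degree + 1 = 2 * W.card := by
  have := sum_cubeExponent_inr_inl hw Finset.univ
  simpa [Finsupp.degree_eq_sum] using this

theorem degree_cubeExponent_inr_inr (W : Finset (Fin n)) :
    (cubeExponent (.inr (.inr W))).degree = 3 * W.card := by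
  simp [cubeExponent, Finsupp.degree_eq_sum, mul_comm]

/-- Squarefree generators are ranked by their largest index, leaving `n`, `n + 1`, `n + 2` for the
others. Positivity of `n` matters for `T = ∅`, where the supremum is 0. -/
theorem cubeRank_inl_lt (hn : 0 < n) (T : Finset (Fin n)) : cubeRank (.inl T) < n :=
  (Finset.sup_lt_iff (by simpa using hn)).2 fun a _ => a.2

theorem le_cubeRank_inr (p : (Finset (Fin n) × Fin n) ⊕ Finset (Fin n)) :
    n ≤ cubeRank (.inr p) := by
  rcases p with ⟨W, w⟩ | W
  · simp only [cubeRank]; split_ifs <;> omega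
  · simp [cubeRank]

theorem cubeRank_inr_inl_lt (W W' : Finset (Fin n)) (w : Fin n) :
    cubeRank (.inr (.inl (W, w))) < cubeRank (.inr (.inr W')) := by
  simp only [cubeRank]; split_ifs <;> omega

theorem exists_mem_cubeRank_inl {T : Finset (Fin n)} (hT : T.Nonempty) :
    ∃ M ∈ T, cubeRank (.inl T) = (M : ℕ) ∧ ∀ a ∈ T, a ≤ M := by
  obtain ⟨M, hM, h⟩ := Finset.exists_mem_eq_sup T hT fun a => (a : ℕ)
  exact ⟨M, hM, h, fun a ha => Fin.le_def.2 (h ▸ Finset.le_sup (f := fun a : Fin n => (a : ℕ)) ha)⟩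

/-- The three kinds come in this order, with degrees `m + 3 ≤ 2 * m + 3 ≤ 3 * m + 3`. -/
theorem degree_cubeExponent_mono {m : ℕ} (hn : 0 < n) :
    ∀ i ∈ cubeGenerators n m, ∀ j ∈ cubeGenerators n m, cubeRank j ≤ cubeRank i →
      (cubeExponent j).degree ≤ (cubeExponent i).degree := by
  simp only [forall_mem_cubeGenerators]
  refine ⟨fun T hT => ⟨fun T' hT' h => ?_, fun W w hW hw h => ?_, fun W hW h => ?_⟩,
    fun W w hW hw => ⟨fun T hT h => ?_, fun W' w' hW' hw' h => ?_, fun W' hW' h => ?_⟩,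
    fun W hW => ⟨fun T hT h => ?_, fun W' w' hW' hw' h => ?_, fun W' hW' h => ?_⟩⟩
  · simp [degree_cubeExponent_inl, hT, hT']
  · exact absurd ((le_cubeRank_inr _).trans h) (not_le.2 (cubeRank_inl_lt hn T))
  · exact absurd ((le_cubeRank_inr _).trans h) (not_le.2 (cubeRank_inl_lt hn T))
  · have := degree_cubeExponent_inr_inl hw
    rw [degree_cubeExponent_inl]; omega
  · have := degree_cubeExponent_inr_inl hw
    have := degree_cubeExponent_inr_inl hw'
    omega
  · exact absurd h (not_le.2 (cubeRank_inr_inl_lt _ _ _))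
  · rw [degree_cubeExponent_inl, degree_cubeExponent_inr_inr]; omega
  · have := degree_cubeExponent_inr_inl hw'
    rw [degree_cubeExponent_inr_inr]; omega
  · rw [degree_cubeExponent_inr_inr, degree_cubeExponent_inr_inr]; omega

theorem degree_cubeExponent_ne_zero {m : ℕ} :
    ∀ i ∈ cubeGenerators n m, (cubeExponent i).degree ≠ 0 := by
  rw [forall_mem_cubeGenerators]
  refine ⟨fun T hT => ?_, fun W w hW hw => ?_, fun W hW => ?_⟩
  · rw [degree_cubeExponent_inl]; omega
  · have := degree_cubeExponent_inr_inl hw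
    omega
  · rw [degree_cubeExponent_inr_inr]; omega

/-- For `x_T`, exchange the largest element of `T` for the smaller `a`. For `x_W ^ 2 / x_w`, a
variable outside `W` gives a multiple of `x_{W ∪ a}`, while `x_w` gives `x_W ^ 2`, a multiple of
`x_W ^ 2 / x_b` with `b = min W`. Finally `x_W ^ 3 * x_a` is a multiple of `x_{W ∪ a} ^ 2 / x_a`. -/
theorem cubeColon_sound {m : ℕ} (hn : 0 < n) :
    ∀ i ∈ cubeGenerators n m, ∀ a ∈ cubeColon i, ∃ j ∈ cubeGenerators n m,
      cubeRank j < cubeRank i ∧ cubeExponent j ≤ cubeExponent i + Finsupp.single a 1 := by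
  classical
  rw [forall_mem_cubeGenerators]
  refine ⟨fun T hT a ha => ?_, fun W w hW hw a ha => ?_, fun W hW a ha => ?_⟩
  · simp only [cubeColon, Finset.mem_filter_univ] at ha
    obtain ⟨haT, b, hb, hab⟩ := ha
    obtain ⟨M, hM, hMr, hMmax⟩ := exists_mem_cubeRank_inl ⟨b, hb⟩
    have haM : a < M := hab.trans_le (hMmax b hb)
    refine ⟨.inl (insert a (T.erase M)), inl_mem_cubeGenerators.2 ?_, ?_, fun x => ?_⟩
    · rw [Finset.card_insert_of_notMem (fun h => haT (Finset.mem_of_mem_erase h)),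
        Finset.card_erase_of_mem hM]
      omega
    · rw [hMr, cubeRank, Finset.sup_lt_iff (by rw [bot_eq_zero]; exact Nat.zero_lt_of_lt haM)]
      intro x hx
      rcases Finset.mem_insert.1 hx with rfl | hx
      · exact haM
      · exact lt_of_le_of_ne (hMmax x (Finset.mem_of_mem_erase hx))
          (Fin.val_ne_of_ne (Finset.ne_of_mem_erase hx))
    · simp only [cubeExponent, Finsupp.add_apply, Finsupp.equivFunOnFinite_symm_apply_apply,
        Finsupp.single_apply, Finset.mem_insert, Finset.mem_erase]
      grind
  · simp only [cubeColon, Finset.mem_filter_univ] at ha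
    rcases ha with ha | ⟨rfl, hb⟩
    · refine ⟨.inl (insert a W), inl_mem_cubeGenerators.2 ?_,
        (cubeRank_inl_lt hn _).trans_le (le_cubeRank_inr _), fun x => ?_⟩
      · rw [Finset.card_insert_of_notMem ha, hW]
      · simp only [cubeExponent, Finsupp.add_apply, Finsupp.equivFunOnFinite_symm_apply_apply,
          Finsupp.single_apply, Finset.mem_insert]
        grind
    · obtain ⟨b, hbW, hbmin⟩ := Finset.exists_min_image W id ⟨a, hw⟩
      have hba : b ≠ a := by
        rintro rfl
        obtain ⟨c, hc, hcb⟩ := hb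
        exact absurd (hbmin c hc) (not_le.2 hcb)
      refine ⟨.inr (.inl (W, b)), inr_inl_mem_cubeGenerators.2 ⟨hW, hbW⟩, ?_, fun x => ?_⟩
      · rw [cubeRank, cubeRank, if_pos hb, if_neg]
        · exact Nat.lt_succ_self _
        · rintro ⟨c, hc, hcb⟩
          exact absurd (hbmin c hc) (not_le.2 hcb)
      · simp only [cubeExponent, Finsupp.add_apply, Finsupp.equivFunOnFinite_symm_apply_apply,
          Finsupp.single_apply]
        grind
  · simp only [cubeColon, Finset.mem_compl] at ha
    refine ⟨.inr (.inl (insert a W, a)), inr_inl_mem_cubeGenerators.2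
      ⟨?_, Finset.mem_insert_self _ _⟩, cubeRank_inr_inl_lt _ _ _, fun x => ?_⟩
    · rw [Finset.card_insert_of_notMem ha, hW]
    · simp only [cubeExponent, Finsupp.add_apply, Finsupp.equivFunOnFinite_symm_apply_apply,
        Finsupp.single_apply, Finset.mem_insert]
      grind

theorem exists_mem_notMem_of_card_le {W T : Finset (Fin n)} (hne : T ≠ W)
    (h : W.card ≤ T.card) : ∃ a ∈ T, a ∉ W := by
  by_contra! h'
  exact hne (Finset.eq_of_subset_of_card_le h' h)

/-- The support of an earlier generator is at least as large, so if it is different it contains an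
index outside the present support; for two squarefree generators the ranks place this index below
the maximum of `T`. If the supports agree, both generators are of the form `x_W ^ 2 / x_w` and the
variable is `x_w`. -/
theorem cubeColon_complete {m : ℕ} (hn : 0 < n) :
    ∀ i ∈ cubeGenerators n m, ∀ j ∈ cubeGenerators n m, j ≠ i → cubeRank j ≤ cubeRank i →
      ∃ a ∈ cubeColon i, cubeExponent i a < cubeExponent j a := by
  classical
  simp only [forall_mem_cubeGenerators]
  have hcard : ∀ {W T : Finset (Fin n)}, W.card < T.card → ∃ a ∈ T, a ∉ W := fun h =>
    exists_mem_notMem_of_card_le (by rintro rfl; exact lt_irrefl _ h) h.le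
  refine ⟨fun T hT => ⟨fun T' hT' hne h => ?_, fun W w hW hw _ h => ?_, fun W hW _ h => ?_⟩,
    fun W w hW hw => ⟨fun T hT _ h => ?_, fun W' w' hW' hw' hne h => ?_, fun W' hW' _ h => ?_⟩,
    fun W hW => ⟨fun T hT _ h => ?_, fun W' w' hW' hw' _ h => ?_, fun W' hW' hne h => ?_⟩⟩
  · obtain ⟨a, haT', haT⟩ := exists_mem_notMem_of_card_le
      (fun h => hne (congrArg _ h) : T' ≠ T) (by omega)
    obtain ⟨M, hM, hMr, -⟩ := exists_mem_cubeRank_inl (T := T) (Finset.card_pos.1 (by omega))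
    obtain ⟨M', -, hMr', hMmax'⟩ := exists_mem_cubeRank_inl ⟨a, haT'⟩
    rw [hMr, hMr'] at h
    refine ⟨a, ?_, by simp [cubeExponent, haT, haT']⟩
    simp only [cubeColon, Finset.mem_filter_univ]
    exact ⟨haT, M, hM, lt_of_le_of_ne ((hMmax' a haT').trans h) fun h => haT (h ▸ hM)⟩
  · exact absurd ((le_cubeRank_inr _).trans h) (not_le.2 (cubeRank_inl_lt hn T))
  · exact absurd ((le_cubeRank_inr _).trans h) (not_le.2 (cubeRank_inl_lt hn T))
  · obtain ⟨a, haT, haW⟩ := hcard (show W.card < T.card by omega)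
    have haw : a ≠ w := fun h => haW (h ▸ hw)
    exact ⟨a, by simp [cubeColon, haW], by simp [cubeExponent, haW, haT, haw]⟩
  · by_cases hWW : W' = W
    · subst hWW
      have hww : w' ≠ w := by rintro rfl; exact hne rfl
      by_cases hmin : ∃ b ∈ W', b < w
      · exact ⟨w, by simpa [cubeColon, hw] using hmin, by simp [cubeExponent, hw, hww.symm]⟩
      -- If `w` is the least element of `W'` then `w'` is not, and the ranks would give `n + 1 ≤ n`.
      · rw [cubeRank, cubeRank, if_neg hmin, if_pos] at h
        · omega
        · push Not at hmin
          exact ⟨w, hw, lt_of_le_of_ne (hmin w' hw') hww.symm⟩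
    · obtain ⟨a, haW', haW⟩ := exists_mem_notMem_of_card_le hWW (by omega)
      have haw : a ≠ w := fun h => haW (h ▸ hw)
      refine ⟨a, by simp [cubeColon, haW], ?_⟩
      simp only [cubeExponent, Finsupp.equivFunOnFinite_symm_apply_apply, if_neg haw, if_neg haW,
        if_pos haW']
      split_ifs <;> omega
  · exact absurd h (not_le.2 (cubeRank_inr_inl_lt _ _ _))
  · obtain ⟨a, haT, haW⟩ := hcard (show W.card < T.card by omega)
    exact ⟨a, by simp [cubeColon, haW], by simp [cubeExponent, haW, haT]⟩
  · obtain ⟨a, haW', haW⟩ := hcard (show W.card < W'.card by omega)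
    refine ⟨a, by simp [cubeColon, haW], ?_⟩
    simp only [cubeExponent, Finsupp.equivFunOnFinite_symm_apply_apply, if_neg haW, if_pos haW']
    split_ifs <;> omega
  · obtain ⟨a, haW', haW⟩ := exists_mem_notMem_of_card_le
      (fun h => hne (congrArg _ (congrArg _ h)) : W' ≠ W) (by omega)
    exact ⟨a, by simp [cubeColon, haW], by simp [cubeExponent, haW, haW']⟩

/-- A `c`-set meets `T` in at least `|T| - m` elements, which gives one direction. Conversely, fill
up the complement of the support of `x` to a `c`-set: this bounds single exponents for support size
`m + 1` and sums of two for `m + 2`. With at least `m + 3` elements a squarefree generator divides,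
and at most `m` are impossible. -/
theorem exists_cubeExponent_le_iff {c m : ℕ} (hn : c + m = n) (x : Fin n →₀ ℕ) :
    (∃ i ∈ cubeGenerators n m, cubeExponent i ≤ x) ↔
      ∀ A : Finset (Fin n), A.card = c → 3 ≤ ∑ a ∈ A, x a := by
  classical
  constructor
  · rintro ⟨i, hi, hle⟩ A hA
    refine le_trans ?_ (Finset.sum_le_sum fun a _ => hle a)
    have hcard : ∀ T : Finset (Fin n), c + T.card ≤ n + (A ∩ T).card := fun T => by
      rw [← hA, ← Finset.card_union_add_card_inter]
      exact Nat.add_le_add_right ((Finset.card_le_univ _).trans_eq (Fintype.card_fin n)) _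
    revert i
    rw [forall_mem_cubeGenerators]
    refine ⟨fun T hT _ => ?_, fun W w hW hw _ => ?_, fun W hW _ => ?_⟩
    · have := hcard T
      simp only [cubeExponent, Finsupp.equivFunOnFinite_symm_apply_apply, Finset.sum_ite_mem,
        Finset.sum_const, smul_eq_mul]
      omega
    · have h1 := hcard W
      have h2 := sum_cubeExponent_inr_inl hw A
      split_ifs at h2 <;> omega
    · have := hcard W
      simp only [cubeExponent, Finsupp.equivFunOnFinite_symm_apply_apply, Finset.sum_ite_mem,
        Finset.sum_const, smul_eq_mul]
      omega
  · intro h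
    have hsupp : ∀ a, a ∉ x.support → x a = 0 := fun a => Finsupp.notMem_support_iff.1
    have hcompl : x.support.card + x.supportᶜ.card = n := by
      rw [Finset.card_add_card_compl, Fintype.card_fin]
    have hzero : ∑ a ∈ x.supportᶜ, x a = 0 :=
      Finset.sum_eq_zero fun a ha => hsupp a (Finset.mem_compl.1 ha)
    rcases le_or_gt (m + 3) x.support.card with h3 | h3
    · obtain ⟨T, hTx, hT⟩ := Finset.exists_subset_card_eq h3
      refine ⟨.inl T, inl_mem_cubeGenerators.2 hT, fun a => ?_⟩
      simp only [cubeExponent, Finsupp.equivFunOnFinite_symm_apply_apply]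
      split_ifs with ha
      · exact Nat.one_le_iff_ne_zero.2 (Finsupp.mem_support_iff.1 (hTx ha))
      · exact Nat.zero_le _
    rcases eq_or_ne x.support.card (m + 2) with h2 | h2
    · obtain ⟨w, hw, hmin⟩ := Finset.exists_min_image x.support x (Finset.card_pos.1 (by omega))
      refine ⟨.inr (.inl (x.support, w)), inr_inl_mem_cubeGenerators.2 ⟨h2, hw⟩, fun a => ?_⟩
      simp only [cubeExponent, Finsupp.equivFunOnFinite_symm_apply_apply]
      split_ifs with haw ha
      · exact Nat.one_le_iff_ne_zero.2 (Finsupp.mem_support_iff.1 (haw ▸ hw))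
      · have hw' : w ∉ x.supportᶜ := by simpa using hw
        have ha' : a ∉ insert w x.supportᶜ := by
          simpa [haw] using ha
        -- The complement has `c - 2` elements, so `x a + x w ≥ 3`; as `x w` is minimal, `x a ≥ 2`.
        have := h (insert a (insert w x.supportᶜ)) (by
          rw [Finset.card_insert_of_notMem ha', Finset.card_insert_of_notMem hw']
          omega)
        rw [Finset.sum_insert ha', Finset.sum_insert hw', hzero] at this
        have := hmin a ha
        omega
      · exact Nat.zero_le _
    rcases eq_or_ne x.support.card (m + 1) with h1 | h1
    · refine ⟨.inr (.inr x.support), inr_inr_mem_cubeGenerators.2 h1, fun a => ?_⟩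
      simp only [cubeExponent, Finsupp.equivFunOnFinite_symm_apply_apply]
      split_ifs with ha
      · have ha' : a ∉ x.supportᶜ := by simpa using ha
        have := h (insert a x.supportᶜ) (by
          rw [Finset.card_insert_of_notMem ha']
          omega)
        rwa [Finset.sum_insert ha', hzero] at this
      · exact Nat.zero_le _
    · obtain ⟨A, hAx, hA⟩ := Finset.exists_subset_card_eq (show c ≤ x.supportᶜ.card by omega)
      have h0 := h A hA
      rw [Finset.sum_eq_zero fun a ha => hsupp a (Finset.mem_compl.1 (hAx ha))] at h0
      omega

theorem monomialIdeal_cubeGenerators {c m : ℕ} (hn : c + m = n) :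
    monomialIdeal k (cubeExponent '' (cubeGenerators n m : Set (CubeIndex n))) =
      starSymbolicPower k n c 3 := by
  ext p
  rw [mem_monomialIdeal_iff, mem_starSymbolicPower_iff]
  refine forall₂_congr fun x _ => ?_
  rw [← exists_cubeExponent_le_iff hn, Set.exists_mem_image]
  rfl

end StarGenerators

/-! ### Summing the contributions of the generators. -/

section BettiSums

variable {n : ℕ}

/-- Sort the sets by their maximum `M`: the other `d` elements are chosen among the `M` smaller
numbers. -/
theorem sum_powersetCard_range_sup (f : ℕ → ℕ) (d n : ℕ) :
    ∑ T ∈ (Finset.range n).powersetCard (d + 1), f (T.sup id) =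
      ∑ M ∈ Finset.range n, M.choose d * f M := by
  induction n with
  | zero => simp
  | succ n ih =>
    have hn : n ∉ Finset.range n := Finset.notMem_range_self
    have hsub : ∀ {T : Finset ℕ} {r : ℕ}, T ∈ (Finset.range n).powersetCard r → n ∉ T :=
      fun hT h => hn ((Finset.mem_powersetCard.1 hT).1 h)
    have hsup : ∀ T ∈ (Finset.range n).powersetCard d, f ((insert n T).sup id) = f n :=
      fun T hT => by
        rw [Finset.sup_insert, id, sup_of_le_left]
        exact Finset.sup_le fun a ha =>
          (Finset.mem_range.1 ((Finset.mem_powersetCard.1 hT).1 ha)).le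
    rw [Finset.sum_range_succ, Finset.range_add_one, Finset.powersetCard_succ_insert hn,
      Finset.sum_union, ih, Finset.sum_image, Finset.sum_congr rfl hsup,
      Finset.sum_const, Finset.card_powersetCard, Finset.card_range, smul_eq_mul]
    · intro T hT T' hT' h
      rw [← Finset.erase_insert (hsub hT), ← Finset.erase_insert (hsub hT')]
      exact congrArg (Finset.erase · n) h
    · rw [Finset.disjoint_left]
      intro T hT hT'
      obtain ⟨T', -, rfl⟩ := Finset.mem_image.1 hT'
      exact hsub hT (Finset.mem_insert_self n T')

theorem sum_powersetCard_fin_sup (f : ℕ → ℕ) (d n : ℕ) :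
    ∑ T ∈ (Finset.univ : Finset (Fin n)).powersetCard (d + 1), f (T.sup fun a => (a : ℕ)) =
      ∑ M ∈ Finset.range n, M.choose d * f M := by
  have h : Finset.range n = Finset.univ.map (Fin.valEmbedding : Fin n ↪ ℕ) := by
    ext a; simp
  rw [← sum_powersetCard_range_sup, h, Finset.powersetCard_map, Finset.sum_map]
  refine Finset.sum_congr rfl fun T _ => ?_
  rw [RelEmbedding.coe_toEmbedding, Finset.mapEmbedding_apply, Finset.sup_map]
  rfl

/-- Choosing `d` and then `i` elements is choosing `d + i` and splitting them; the sum over `M` is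
then the hockey-stick identity. -/
theorem sum_range_choose_mul_choose (d i n : ℕ) :
    ∑ M ∈ Finset.range n, M.choose d * (M - d).choose i =
      n.choose (d + i + 1) * (d + i).choose i := by
  have h1 : ∀ M, M.choose d * (M - d).choose i = M.choose (d + i) * (d + i).choose i := fun M => by
    rw [← Nat.choose_symm_add (a := d) (b := i)]
    rcases le_or_gt (d + i) M with h | h
    · rw [Nat.choose_mul (Nat.le_add_right d i), Nat.add_sub_cancel_left]
    · rw [Nat.choose_eq_zero_of_lt h, zero_mul]
      -- Truncation of `M - d` is harmless, since `M.choose d` vanishes for `M < d`.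
      rcases le_or_gt d M with h' | h'
      · rw [Nat.choose_eq_zero_of_lt (show M - d < i by omega), mul_zero]
      · rw [Nat.choose_eq_zero_of_lt h', zero_mul]
  simp only [h1]
  rw [← Finset.sum_mul]
  congr 1
  induction n with
  | zero => simp
  | succ n ih => rw [Finset.sum_range_succ, ih, Nat.choose_succ_succ, add_comm]

theorem ite_sum_zero {ι : Type*} (p : Prop) [Decidable p] (s : Finset ι) (f : ι → ℕ) :
    (if p then ∑ a ∈ s, f a else 0) = ∑ a ∈ s, if p then f a else 0 := by
  split_ifs <;> simp

/-- Of the `M` indices below `M = max T`, exactly `m + 2` belong to `T`. -/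
theorem card_cubeColon_inl {m : ℕ} {T : Finset (Fin n)} (hT : T.card = m + 3) :
    (cubeColon (.inl T)).card = (T.sup fun a => (a : ℕ)) - (m + 2) := by
  classical
  obtain ⟨M, hM, hMr, hMmax⟩ := exists_mem_cubeRank_inl (T := T) (Finset.card_pos.1 (by omega))
  rw [cubeRank] at hMr
  have h : cubeColon (.inl T) = Finset.Iio M \ T.erase M := by
    ext a
    simp only [cubeColon, Finset.mem_filter_univ, Finset.mem_sdiff, Finset.mem_Iio,
      Finset.mem_erase, not_and]
    constructor
    · rintro ⟨ha, b, hb, hab⟩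
      exact ⟨hab.trans_le (hMmax b hb), fun _ => ha⟩
    · rintro ⟨haM, ha⟩
      exact ⟨ha haM.ne, M, hM, haM⟩
  rw [h, Finset.card_sdiff_of_subset, Finset.card_erase_of_mem hM, hMr, hT, Fin.card_Iio]
  · rfl
  · intro a ha
    exact Finset.mem_Iio.2 (lt_of_le_of_ne (hMmax a (Finset.mem_of_mem_erase ha))
      (Finset.ne_of_mem_erase ha))

theorem sum_choose_card_cubeColon_inl (m i n : ℕ) :
    ∑ T ∈ (Finset.univ : Finset (Fin n)).powersetCard (m + 3),
      (cubeColon (.inl T)).card.choose i = n.choose (m + 3 + i) * (m + 2 + i).choose i := by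
  rw [Finset.sum_congr rfl fun T hT => by
    rw [card_cubeColon_inl (Finset.mem_powersetCard.1 hT).2]]
  rw [sum_powersetCard_fin_sup (fun M => (M - (m + 2)).choose i) (m + 2),
    sum_range_choose_mul_choose]
  congr 2
  omega

/-- The least `w` contributes the `c - 2` variables outside `W`; each of the other `m + 1` choices
has `x_w` in addition. -/
theorem sum_choose_card_cubeColon_inr_inl {W : Finset (Fin n)} {m c : ℕ} (hn : c + m = n)
    (hW : W.card = m + 2) (i : ℕ) :
    ∑ w ∈ W, (cubeColon (.inr (.inl (W, w)))).card.choose i =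
      (c - 2).choose i + (m + 1) * (c - 1).choose i := by
  classical
  obtain ⟨b, hb, hbmin⟩ := Finset.exists_min_image W id (Finset.card_pos.1 (by omega))
  have hc : Wᶜ.card = c - 2 := by
    rw [Finset.card_compl, hW, Fintype.card_fin]; omega
  have hW' : W.card ≤ n := (Finset.card_le_univ W).trans_eq (Fintype.card_fin n)
  have h1 : cubeColon (.inr (.inl (W, b))) = Wᶜ := by
    ext a
    simp only [cubeColon, Finset.mem_filter_univ, Finset.mem_compl, or_iff_left_iff_imp]
    rintro ⟨-, x, hx, hxb⟩
    exact absurd (hbmin x hx) (not_le.2 hxb)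
  have h2 : ∀ w ∈ W.erase b, cubeColon (.inr (.inl (W, w))) = insert w Wᶜ := fun w hw => by
    have : ∃ x ∈ W, x < w := ⟨b, hb, lt_of_le_of_ne (hbmin w (Finset.mem_of_mem_erase hw))
      (Finset.ne_of_mem_erase hw).symm⟩
    ext a
    simp only [cubeColon, Finset.mem_filter_univ, Finset.mem_insert, Finset.mem_compl, this,
      and_true, or_comm]
  rw [← Finset.add_sum_erase W _ hb, h1, hc]
  congr 1
  rw [Finset.sum_congr rfl fun w hw => by
    rw [h2 w hw, Finset.card_insert_of_notMem (by simpa using Finset.mem_of_mem_erase hw), hc],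
    Finset.sum_const, Finset.card_erase_of_mem hb, hW, smul_eq_mul]
  congr 2
  omega

/-- The Betti numbers given by the linear quotients of the symbolic cube. -/
theorem linearQuotientBetti_cube {c m : ℕ} (hn : c + m = n) (hc : 3 ≤ c) (i : ℕ) (j : ℤ) :
    linearQuotientBetti cubeExponent cubeColon (cubeGenerators n m) (i + 1) (i + j) =
      (if j = m + 3 then n.choose (m + 3 + i) * (m + 2 + i).choose i else 0) +
      ((if j = 2 * (m + 1) + 1 then
        n.choose (c - 2) * ((c - 2).choose i + (m + 1) * (c - 1).choose i) else 0) +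
      (if j = 3 * (m + 1) then n.choose (c - 1) * (c - 1).choose i else 0)) := by
  classical
  rw [linearQuotientBetti, cubeGenerators, Finset.sum_disjSum, Finset.sum_disjSum]
  congr 1
  · rw [← sum_choose_card_cubeColon_inl, ite_sum_zero]
    refine Finset.sum_congr rfl fun T hT => if_congr ?_ rfl rfl
    rw [degree_cubeExponent_inl, (Finset.mem_powersetCard.1 hT).2]
    omega
  congr 1
  · rw [Finset.sum_filter, Finset.sum_product]
    have key : ∀ W ∈ (Finset.univ : Finset (Fin n)).powersetCard (m + 2),
        (∑ w, if w ∈ W then (if ((cubeExponent (.inr (.inl (W, w)))).degree : ℤ) + i = i + j then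
          (cubeColon (.inr (.inl (W, w)))).card.choose i else 0) else 0) =
        if j = 2 * (m + 1) + 1 then (c - 2).choose i + (m + 1) * (c - 1).choose i else 0 := by
      intro W hW
      have hW := (Finset.mem_powersetCard.1 hW).2
      rw [← sum_choose_card_cubeColon_inr_inl hn hW, Finset.sum_ite_mem, Finset.univ_inter,
        ite_sum_zero]
      refine Finset.sum_congr rfl fun w hw => if_congr ?_ rfl rfl
      have := degree_cubeExponent_inr_inl hw
      omega
    rw [Finset.sum_congr rfl key, Finset.sum_const, Finset.card_powersetCard, Finset.card_univ,
      Fintype.card_fin, smul_eq_mul, mul_ite, mul_zero, ← Nat.choose_symm (show m + 2 ≤ n by omega),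
      show n - (m + 2) = c - 2 by omega]
  · have key : ∀ W ∈ (Finset.univ : Finset (Fin n)).powersetCard (m + 1),
        (if ((cubeExponent (.inr (.inr W))).degree : ℤ) + i = i + j then
          (cubeColon (.inr (.inr W))).card.choose i else 0) =
        if j = 3 * (m + 1) then (c - 1).choose i else 0 := by
      intro W hW
      have hW := (Finset.mem_powersetCard.1 hW).2
      rw [degree_cubeExponent_inr_inr, cubeColon, Finset.card_compl, Fintype.card_fin, hW,
        show n - (m + 1) = c - 1 by omega]
      exact if_congr (by omega) rfl rfl
    rw [Finset.sum_congr rfl key, Finset.sum_const, Finset.card_powersetCard, Finset.card_univ,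
      Fintype.card_fin, smul_eq_mul, mul_ite, mul_zero, ← Nat.choose_symm (show m + 1 ≤ n by omega),
      show n - (m + 1) = c - 1 by omega]

end BettiSums

theorem corollary4p6 {k : Type u} [Field k] (n c : ℕ) (hc : 3 ≤ c) (hcn : c < n) (i : ℕ) :
    HasGradedBetti (starSymbolicPower k n c 3) i ((i : ℤ) + ((n : ℤ) - c + 3))
      (if i + 3 ≤ c then n.choose (c - 3 - i) * (n - c + 2 + i).choose i else 0) ∧
    HasGradedBetti (starSymbolicPower k n c 3) i ((i : ℤ) + (2 * ((n : ℤ) - c + 1) + 1))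
      (n.choose (c - 2) * ((c - 2).choose i + (n - c + 1) * (c - 1).choose i)) ∧
    HasGradedBetti (starSymbolicPower k n c 3) i ((i : ℤ) + 3 * ((n : ℤ) - c + 1))
      (n.choose (c - 1) * (c - 1).choose i) ∧
    ∀ j : ℤ, j ≠ (n : ℤ) - c + 3 → j ≠ 2 * ((n : ℤ) - c + 1) + 1 → j ≠ 3 * ((n : ℤ) - c + 1) →
      HasGradedBetti (starSymbolicPower k n c 3) i ((i : ℤ) + j) 0 := by
  obtain ⟨m, rfl⟩ := exists_add_of_le hcn.le
  have hn : 0 < c + m := by omega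
  have hres := hasMinimalResolution_of_linearQuotients (k := k) cubeExponent cubeColon cubeRank
    (cubeGenerators (c + m) m) (degree_cubeExponent_mono hn) degree_cubeExponent_ne_zero
    (cubeColon_sound hn) (cubeColon_complete hn)
  rw [monomialIdeal_cubeGenerators rfl] at hres
  have key : ∀ (j : ℤ) (β : ℕ), linearQuotientBetti cubeExponent cubeColon
      (cubeGenerators (c + m) m) (i + 1) (i + j) = β →
      HasGradedBetti (starSymbolicPower k (c + m) c 3) i (i + j) β :=
    fun j β h => h ▸ hres.hasGradedBetti i (i + j)
  have hm : ((c + m : ℕ) : ℤ) - c = m := by push_cast; ring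
  have hm' : c + m - c = m := by omega
  rw [hm, hm']
  refine ⟨key _ _ ?_, key _ _ ?_, key _ _ ?_, fun j h1 h2 h3 => key _ _ ?_⟩ <;>
    rw [linearQuotientBetti_cube rfl hc]
  -- Here `c < n` gives `m ≥ 1`, so the degrees `m + 3`, `2 * m + 3`, `3 * m + 3` are distinct.
  · rw [if_pos rfl, if_neg (by omega), if_neg (by omega), add_zero, add_zero]
    -- The guard `i + 3 ≤ c` keeps truncation of `c - 3 - i` from producing `n.choose 0 = 1`; beyond
    -- it `m + 3 + i` exceeds the number of variables.
    split_ifs with hi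
    · rw [← Nat.choose_symm (show m + 3 + i ≤ c + m by omega),
        show c + m - (m + 3 + i) = c - 3 - i by omega]
    · rw [Nat.choose_eq_zero_of_lt (by omega), zero_mul]
  · rw [if_neg (by omega), if_pos rfl, if_neg (by omega), add_zero, zero_add]
  · rw [if_neg (by omega), if_neg (by omega), if_pos rfl, zero_add, zero_add]
  · rw [if_neg h1, if_neg h2, if_neg h3]
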